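/- Let $k$ be a field of characteristic zero and let $L$ be a Lie algebra over $k$ with a decreasing filtration $L=L^1\supseteq L^2\supseteq\cdots$ such that $[L^i,L^j]\subseteq L^{i+j}$. Assume that all quotients $L_p=L/L^{p+1}$ are finite dimensional and that $L$ is complete, that is, the canonical map $L\to\varprojlim_p L_p$ is bijective. Filter the enveloping algebra $U(L)$ by the two-sided ideals $F^1=U(L)_+$ (the augmentation ideal) and $F^{p+1}=F^p\cdot U(L)_++(L^{p+1})$, and let $\hat U(L)=\varprojlim_p U(L)/F^p$, with the completed coproduct $\Delta:\hat U(L)\to\hat U(L)\,\hat\otimes\,\hat U(L)=\varprojlim_p U(L)/F^p\otimes U(L)/F^p$ and the augmentation $\epsilon:\hat U(L)\to k$ induced by those of $U(L)$. Let $G(\hat U(L))$ be the set of grouplike elements, i.e. of all $g\in\hat U(L)$ with $\Delta(g)=g\otimes g$ and $\epsilon(g)=1$. Let $K=\varinjlim_p \mathrm{Hom}_k(L_p,k)$ and $U^c(K)=\varinjlim_{j,p}\bigl(U(L_p)/F^{j+1}U(L_p)\bigr)^*$. Here $F$ on $U(L_p)$ is formed in the same way from the induced filtration of $L_p$, and both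 direct limits are increasing unions inside $\mathrm{Hom}_k(L,k)$ and $\mathrm{Hom}_k(U(L),k)$, respectively. $U^c(K)$ is a commutative algebra under the (shuffle) product $(fg)(x)=(f\otimes g)(\Delta x)$, whose unit is the counit of $U(L)$; its counit is $\epsilon(f)=f(1)$. Let $\phi:U^c(K)\to K$ be the restriction of functionals along $L\to U(L)$. Let $\mathrm{Hom}_{Alg}(U^c(K),k)$ be the set of characters, i.e. (unital) algebra homomorphisms $U^c(K)\to k$, and let $\mathrm{Hom}_{Inf}(U^c(K),k)$ be the space of infinitesimal characters, i.e. linear maps $\alpha:U^c(K)\to k$ with $\alpha(uv)=\epsilon(u)\alpha(v)+\alpha(u)\epsilon(v)$ for all $u,v$. Then the duality map $\hat U(L)\to\mathrm{Hom}_k(U^c(K),k)$, given by evaluation of functionals, is a linear isomorphism, and via this isomorphism: a. $\mathrm{Hom}_{Inf}(U^c(K),k)\cong\mathrm{Hom}_k(K,k)\cong L$ as vector spaces. The first isomorphism is inverse to $\xi\mapsto\xi\circ\phi$; the second is inverse to the map sending $x\in L$ to evaluation at $x$; and an infinitesimal character $\alpha$ which corresponds to $x\in L$ is the image under the duality map of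 the image of $x$ in $\hat U(L)$. b. $\mathrm{Hom}_{Alg}(U^c(K),k)\cong G(\hat U(L))$: the duality map restricts to a bijection from the set of grouplike elements onto the set of characters. -/

import Mathlib

open scoped TensorProduct

noncomputable section

namespace UniversalEnvelopingAlgebra

section Bialgebra

variable (k : Type*) {L L' : Type*} [CommRing k] [LieRing L] [LieAlgebra k L]
  [LieRing L'] [LieAlgebra k L']

attribute [local instance 100] LieRing.ofAssociativeRing

theorem algHom_ext_ι {A : Type*} [Ring A] [Algebra k A]
    {f g : UniversalEnvelopingAlgebra k L →ₐ[k] A} (h : ∀ l, f (ι k l) = g (ι k l)) : f = g :=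
  hom_ext k (LieHom.ext h)

/-- The canonical map `L → U(L)` as a linear map. -/
def ιLin : L →ₗ[k] UniversalEnvelopingAlgebra k L := (ι k : L →ₗ⁅k⁆ UniversalEnvelopingAlgebra k L)

theorem ιLin_apply (l : L) : ιLin k l = ι k l := rfl

/-- The counit (augmentation) of `U(L)`: the algebra homomorphism `U(L) → k` killing `L`. -/
def counitHom : UniversalEnvelopingAlgebra k L →ₐ[k] k := lift k 0

theorem counitHom_ι (l : L) : counitHom k (ι k l) = 0 :=
  lift_ι_apply k _ l

/-- The (shuffle) coproduct of `U(L)`: the algebra homomorphism with `Δ(l) = l ⊗ 1 + 1 ⊗ l`. -/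
def comulHom : UniversalEnvelopingAlgebra k L →ₐ[k]
    UniversalEnvelopingAlgebra k L ⊗[k] UniversalEnvelopingAlgebra k L :=
  lift k
    { toFun := fun l => ι k l ⊗ₜ 1 + 1 ⊗ₜ ι k l
      map_add' := fun a b => by
        simp only [map_add, TensorProduct.add_tmul, TensorProduct.tmul_add]; abel
      map_smul' := fun c a => by
        simp [TensorProduct.smul_tmul', TensorProduct.tmul_smul]
      map_lie' := fun {a b} => by
        simp only [LieHom.map_lie, LieRing.of_associative_ring_bracket, TensorProduct.sub_tmul,
          TensorProduct.tmul_sub, mul_add, add_mul, Algebra.TensorProduct.tmul_mul_tmul,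
          mul_one, one_mul]
        abel }

theorem comulHom_ι (l : L) :
    comulHom k (ι k l) = ι k l ⊗ₜ 1 + 1 ⊗ₜ ι k l :=
  lift_ι_apply k _ l

/-- The standard bialgebra structure on the universal enveloping algebra. -/
instance instBialgebra : Bialgebra k (UniversalEnvelopingAlgebra k L) :=
  Bialgebra.ofAlgHom (comulHom k) (counitHom k)
    (algHom_ext_ι k fun l => by
      simp [-ι_apply, comulHom_ι, Algebra.TensorProduct.one_def, TensorProduct.tmul_add,
        TensorProduct.add_tmul, add_assoc])
    (algHom_ext_ι k fun l => by simp [-ι_apply, comulHom_ι, counitHom_ι])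
    (algHom_ext_ι k fun l => by simp [-ι_apply, comulHom_ι, counitHom_ι])

theorem comul_eq (x : UniversalEnvelopingAlgebra k L) :
    Coalgebra.comul (R := k) x = comulHom k x := rfl

theorem counit_eq (x : UniversalEnvelopingAlgebra k L) :
    Coalgebra.counit (R := k) x = counitHom k x := rfl

instance instIsCocomm : Coalgebra.IsCocomm k (UniversalEnvelopingAlgebra k L) where
  comm_comp_comul := by
    have h : ((Algebra.TensorProduct.comm k (UniversalEnvelopingAlgebra k L)
        (UniversalEnvelopingAlgebra k L)).toAlgHom).comp (comulHom k) = comulHom k :=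
      algHom_ext_ι k fun l => by simp [-ι_apply, comulHom_ι, add_comm]
    exact congrArg AlgHom.toLinearMap h

/-- Functoriality of the enveloping algebra. -/
def mapHom (f : L →ₗ⁅k⁆ L') :
    UniversalEnvelopingAlgebra k L →ₐ[k] UniversalEnvelopingAlgebra k L' :=
  lift k ((ι k).comp f)

theorem mapHom_ι (f : L →ₗ⁅k⁆ L') (l : L) :
    mapHom k f (ι k l) = ι k (f l) :=
  lift_ι_apply k _ l

theorem counitHom_mapHom (f : L →ₗ⁅k⁆ L') (x : UniversalEnvelopingAlgebra k L) :
    counitHom k (mapHom k f x) = counitHom k x :=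
  DFunLike.congr_fun (f := (counitHom k).comp (mapHom k f)) (g := counitHom k)
    (algHom_ext_ι k fun l => by simp [-ι_apply, mapHom_ι, counitHom_ι]) x

/-- `U(L)` is spanned, as an algebra, by `L`. -/
theorem induction_ι {S : Subalgebra k (UniversalEnvelopingAlgebra k L)}
    (h : ∀ l, ι k l ∈ S) (x : UniversalEnvelopingAlgebra k L) : x ∈ S := by
  let f : L →ₗ⁅k⁆ S :=
    { toFun := fun l => ⟨ι k l, h l⟩
      map_add' := fun a b => Subtype.ext (by simp [-ι_apply])
      map_smul' := fun a b => Subtype.ext (by simp [-ι_apply])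
      map_lie' := fun {a b} => Subtype.ext (by
        simp [-ι_apply, LieRing.of_associative_ring_bracket]) }
  have e : (S.val.comp (lift k f)) = AlgHom.id k _ :=
    algHom_ext_ι k fun l => by
      simp only [AlgHom.comp_apply, lift_ι_apply, AlgHom.id_apply]; rfl
  have := DFunLike.congr_fun e x
  rw [← AlgHom.id_apply (R := k) x, ← this]
  exact (lift k f x).2

theorem mapHom_surjective (f : L →ₗ⁅k⁆ L') (hf : Function.Surjective f) :
    Function.Surjective (mapHom k f) := fun x => by
  refine induction_ι k (S := (mapHom k f).range) (fun l => ?_) x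
  obtain ⟨a, rfl⟩ := hf l
  exact ⟨ι k a, mapHom_ι k f a⟩

end Bialgebra

end UniversalEnvelopingAlgebra

/-- A filtered Lie algebra: a decreasing filtration `L = L¹ ⊇ L² ⊇ ⋯` with `[Lⁱ, Lʲ] ⊆ Lⁱ⁺ʲ`
(such `Lⁱ` are automatically ideals).  The index `0` is a dummy: `L⁰ = L` is forced. -/
structure LieFiltration (k L : Type*) [CommRing k] [LieRing L] [LieAlgebra k L] where
  /-- The `i`-th piece `Lⁱ`. -/
  fil : ℕ → LieIdeal k L
  fil_one : fil 1 = ⊤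
  anti : Antitone fil
  lie_mem : ∀ i j, ∀ x ∈ fil i, ∀ y ∈ fil j, ⁅x, y⁆ ∈ fil (i + j)

namespace LieFiltration

open UniversalEnvelopingAlgebra

section Basic

variable {k L : Type*} [CommRing k] [LieRing L] [LieAlgebra k L] (𝓕 : LieFiltration k L)

/-- The quotient Lie algebra `L_p = L / Lᵖ⁺¹`. -/
abbrev Lq (p : ℕ) : Type _ := L ⧸ 𝓕.fil (p + 1)

/-- The projection `L → L_p` as a homomorphism of Lie algebras. -/
def toLq (p : ℕ) : L →ₗ⁅k⁆ 𝓕.Lq p :=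
  { (𝓕.fil (p + 1)).toSubmodule.mkQ with map_lie' := fun {_ _} => rfl }

theorem toLq_surjective (p : ℕ) : Function.Surjective (𝓕.toLq p) :=
  Submodule.mkQ_surjective _

theorem toLq_eq_zero {p : ℕ} {x : L} : 𝓕.toLq p x = 0 ↔ x ∈ 𝓕.fil (p + 1) :=
  Submodule.Quotient.mk_eq_zero _

/-- The transition map `L_q → L_p` for `p ≤ q`. -/
def LqFactor {p q : ℕ} (h : p ≤ q) : 𝓕.Lq q →ₗ[k] 𝓕.Lq p :=
  Submodule.factor (p := (𝓕.fil (q + 1)).toSubmodule) (p' := (𝓕.fil (p + 1)).toSubmodule)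
    (𝓕.anti (Nat.add_le_add_right h 1))

/-- `L` is complete: the canonical map from `L` to the inverse limit of the `L_p` is bijective. -/
def IsComplete : Prop :=
  ∀ s : ∀ p, 𝓕.Lq p, (∀ p q (h : p ≤ q), 𝓕.LqFactor h (s q) = s p) →
    ∃! x : L, ∀ p, 𝓕.toLq p x = s p

/-- The filtration induced on `L_p`, by the images of the `Lⁱ`. -/
def quot (p : ℕ) : LieFiltration k (𝓕.Lq p) where
  fil i :=
    { (𝓕.fil i).toSubmodule.map (𝓕.toLq p : L →ₗ[k] 𝓕.Lq p) with
      lie_mem := by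
        rintro x _ ⟨y, hy, rfl⟩
        obtain ⟨x, rfl⟩ := 𝓕.toLq_surjective p x
        exact ⟨⁅x, y⁆, (𝓕.fil i).lie_mem hy, (𝓕.toLq p).map_lie x y⟩ }
  fil_one := by
    refine eq_top_iff.2 fun x _ => ?_
    obtain ⟨x, rfl⟩ := 𝓕.toLq_surjective p x
    exact ⟨x, by rw [𝓕.fil_one]; trivial, rfl⟩
  anti i j h := by
    rintro _ ⟨x, hx, rfl⟩
    exact ⟨x, 𝓕.anti h hx, rfl⟩
  lie_mem := by
    rintro i j _ ⟨x, hx, rfl⟩ _ ⟨y, hy, rfl⟩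
    exact ⟨⁅x, y⁆, 𝓕.lie_mem i j x hx y hy, (𝓕.toLq p).map_lie x y⟩

theorem mem_quot {p i : ℕ} {y : 𝓕.Lq p} :
    y ∈ (𝓕.quot p).fil i ↔ ∃ x ∈ 𝓕.fil i, 𝓕.toLq p x = y := Iff.rfl

/-- The augmentation ideal `U(L)₊`. -/
abbrev aug (k L : Type*) [CommRing k] [LieRing L] [LieAlgebra k L] :
    Ideal (UniversalEnvelopingAlgebra k L) := RingHom.ker (counitHom k (L := L))

/-- The filtration `F` of the enveloping algebra by two-sided ideals: `F¹ = U(L)₊` and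
`Fᵖ⁺¹ = Fᵖ · U(L)₊ + (Lᵖ⁺¹)`, where `(Lᵖ⁺¹)` is the two-sided ideal generated by `Lᵖ⁺¹`;
by convention `F⁰ = U(L)`. -/
def uFil : ℕ → Ideal (UniversalEnvelopingAlgebra k L)
  | 0 => ⊤
  | 1 => aug k L
  | p + 2 => uFil (p + 1) * aug k L ⊔ (TwoSidedIdeal.span (ι k '' (𝓕.fil (p + 2) : Set L))).asIdeal

instance aug_isTwoSided : (aug k L).IsTwoSided :=
  ⟨fun b ha => by
    rw [RingHom.mem_ker] at ha ⊢
    rw [map_mul, ha, zero_mul]⟩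

theorem isTwoSided_sup {R : Type*} [Ring R] (I J : Ideal R) [I.IsTwoSided] [J.IsTwoSided] :
    (I ⊔ J).IsTwoSided :=
  ⟨fun b ha => by
    obtain ⟨x, hx, y, hy, rfl⟩ := Submodule.mem_sup.1 ha
    rw [add_mul]
    exact Submodule.add_mem_sup (Ideal.IsTwoSided.mul_mem_of_left b hx)
      (Ideal.IsTwoSided.mul_mem_of_left b hy)⟩

instance uFil_isTwoSided : ∀ p, (𝓕.uFil p).IsTwoSided
  | 0 => inferInstanceAs (⊤ : Ideal _).IsTwoSided
  | 1 => aug_isTwoSided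
  | p + 2 => by
    have := uFil_isTwoSided (p + 1)
    exact isTwoSided_sup _ _

theorem ι_mem_uFil {p : ℕ} {x : L} (hx : x ∈ 𝓕.fil p) : ι k x ∈ 𝓕.uFil p := by
  match p with
  | 0 => exact trivial
  | 1 => exact counitHom_ι k x
  | p + 2 =>
    exact Submodule.mem_sup_right (TwoSidedIdeal.subset_span ⟨x, hx, rfl⟩)

theorem mul_aug_le (p : ℕ) : 𝓕.uFil p * aug k L ≤ 𝓕.uFil (p + 1) := by
  match p with
  | 0 => exact Ideal.mul_le.2 fun r _ s hs => Ideal.mul_mem_left _ r hs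
  | p + 1 => exact le_sup_left

/-- Induction principle for the elements of `Fᵖ⁺¹`. -/
theorem uFil_succ_le (p : ℕ) {S : AddSubgroup (UniversalEnvelopingAlgebra k L)}
    (h1 : ∀ a ∈ 𝓕.uFil p, ∀ b ∈ aug k L, a * b ∈ S)
    (h2 : ∀ a, ∀ x ∈ 𝓕.fil (p + 1), ∀ b, a * ι k x * b ∈ S) :
    ∀ y ∈ 𝓕.uFil (p + 1), y ∈ S := by
  match p with
  | 0 => exact fun y hy => one_mul y ▸ h1 1 trivial y hy
  | p + 1 =>
    intro y hy
    obtain ⟨a, ha, b, hb, rfl⟩ := Submodule.mem_sup.1 hy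
    refine S.add_mem ?_ ?_
    · refine Submodule.mul_induction_on ha h1 fun x y hx hy => S.add_mem hx hy
    · have hb' : b ∈ TwoSidedIdeal.span (ι k '' (𝓕.fil (p + 2) : Set L)) := hb
      rw [TwoSidedIdeal.mem_span_iff_mem_addSubgroup_closure] at hb'
      refine (AddSubgroup.closure_le S).2 ?_ hb'
      rintro _ ⟨_, ⟨u, -, _, ⟨x, hx, rfl⟩, rfl⟩, v, -, rfl⟩
      exact h2 u x hx v

theorem uFil_succ_le_self (p : ℕ) : 𝓕.uFil (p + 1) ≤ 𝓕.uFil p := by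
  refine 𝓕.uFil_succ_le p (S := (𝓕.uFil p).toAddSubgroup) (fun a ha b _ => ?_) fun a x hx b => ?_
  · exact Ideal.IsTwoSided.mul_mem_of_left b ha
  · exact Ideal.IsTwoSided.mul_mem_of_left b
      (Ideal.mul_mem_left _ a (𝓕.ι_mem_uFil (𝓕.anti (Nat.le_succ p) hx)))

theorem uFil_anti : Antitone 𝓕.uFil := antitone_nat_of_succ_le 𝓕.uFil_succ_le_self

/-- `D n = ∑_{i+j=n} Fⁱ ⊗ Fʲ` inside `U(L) ⊗ U(L)`. -/
def tensorFil (n : ℕ) : AddSubgroup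
    (UniversalEnvelopingAlgebra k L ⊗[k] UniversalEnvelopingAlgebra k L) :=
  AddSubgroup.closure {z | ∃ i j, i + j = n ∧ ∃ x ∈ 𝓕.uFil i, ∃ y ∈ 𝓕.uFil j, x ⊗ₜ y = z}

theorem tmul_mem_tensorFil {n i j : ℕ} (h : i + j = n) {x y : UniversalEnvelopingAlgebra k L}
    (hx : x ∈ 𝓕.uFil i) (hy : y ∈ 𝓕.uFil j) : x ⊗ₜ[k] y ∈ 𝓕.tensorFil n :=
  AddSubgroup.subset_closure ⟨i, j, h, x, hx, y, hy, rfl⟩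

theorem mul_mem_tensorFil_left {n : ℕ}
    (a : UniversalEnvelopingAlgebra k L ⊗[k] UniversalEnvelopingAlgebra k L)
    {z : UniversalEnvelopingAlgebra k L ⊗[k] UniversalEnvelopingAlgebra k L}
    (hz : z ∈ 𝓕.tensorFil n) : a * z ∈ 𝓕.tensorFil n := by
  induction a with
  | zero => simp [(𝓕.tensorFil n).zero_mem]
  | add a b ha hb => rw [add_mul]; exact (𝓕.tensorFil n).add_mem ha hb
  | tmul a b =>
    refine AddSubgroup.closure_induction
      (p := fun z _ => a ⊗ₜ[k] b * z ∈ 𝓕.tensorFil n) ?_ ?_ ?_ ?_ hz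
    · rintro _ ⟨i, j, h, x, hx, y, hy, rfl⟩
      rw [Algebra.TensorProduct.tmul_mul_tmul]
      exact 𝓕.tmul_mem_tensorFil h (Ideal.mul_mem_left _ a hx) (Ideal.mul_mem_left _ b hy)
    · rw [mul_zero]; exact (𝓕.tensorFil n).zero_mem
    · intro x y _ _ hx hy; rw [mul_add]; exact (𝓕.tensorFil n).add_mem hx hy
    · intro x _ hx; rw [mul_neg]; exact (𝓕.tensorFil n).neg_mem hx

theorem mul_mem_tensorFil_right {n : ℕ}
    (a : UniversalEnvelopingAlgebra k L ⊗[k] UniversalEnvelopingAlgebra k L)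
    {z : UniversalEnvelopingAlgebra k L ⊗[k] UniversalEnvelopingAlgebra k L}
    (hz : z ∈ 𝓕.tensorFil n) : z * a ∈ 𝓕.tensorFil n := by
  induction a with
  | zero => simp [(𝓕.tensorFil n).zero_mem]
  | add a b ha hb => rw [mul_add]; exact (𝓕.tensorFil n).add_mem ha hb
  | tmul a b =>
    refine AddSubgroup.closure_induction
      (p := fun z _ => z * a ⊗ₜ[k] b ∈ 𝓕.tensorFil n) ?_ ?_ ?_ ?_ hz
    · rintro _ ⟨i, j, h, x, hx, y, hy, rfl⟩
      rw [Algebra.TensorProduct.tmul_mul_tmul]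
      exact 𝓕.tmul_mem_tensorFil h (Ideal.IsTwoSided.mul_mem_of_left a hx)
        (Ideal.IsTwoSided.mul_mem_of_left b hy)
    · rw [zero_mul]; exact (𝓕.tensorFil n).zero_mem
    · intro x y _ _ hx hy; rw [add_mul]; exact (𝓕.tensorFil n).add_mem hx hy
    · intro x _ hx; rw [neg_mul]; exact (𝓕.tensorFil n).neg_mem hx

theorem mul_mem_tensorFil_succ {n : ℕ}
    {z w : UniversalEnvelopingAlgebra k L ⊗[k] UniversalEnvelopingAlgebra k L}
    (hz : z ∈ 𝓕.tensorFil n) (hw : w ∈ 𝓕.tensorFil 1) : z * w ∈ 𝓕.tensorFil (n + 1) := by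
  refine AddSubgroup.closure_induction
    (p := fun w _ => z * w ∈ 𝓕.tensorFil (n + 1)) ?_ ?_ ?_ ?_ hw
  · rintro _ ⟨i', j', h', x', hx', y', hy', rfl⟩
    refine AddSubgroup.closure_induction
      (p := fun z _ => z * x' ⊗ₜ[k] y' ∈ 𝓕.tensorFil (n + 1)) ?_ ?_ ?_ ?_ hz
    · rintro _ ⟨i, j, h, x, hx, y, hy, rfl⟩
      rw [Algebra.TensorProduct.tmul_mul_tmul]
      rcases (by omega : (i' = 1 ∧ j' = 0) ∨ (i' = 0 ∧ j' = 1)) with ⟨rfl, rfl⟩ | ⟨rfl, rfl⟩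
      · exact 𝓕.tmul_mem_tensorFil (i := i + 1) (j := j) (by omega)
          (𝓕.mul_aug_le i (Ideal.mul_mem_mul hx hx')) (Ideal.IsTwoSided.mul_mem_of_left _ hy)
      · exact 𝓕.tmul_mem_tensorFil (i := i) (j := j + 1) (by omega)
          (Ideal.IsTwoSided.mul_mem_of_left _ hx) (𝓕.mul_aug_le j (Ideal.mul_mem_mul hy hy'))
    · rw [zero_mul]; exact (𝓕.tensorFil _).zero_mem
    · intro x y _ _ hx hy; rw [add_mul]; exact (𝓕.tensorFil _).add_mem hx hy
    · intro x _ hx; rw [neg_mul]; exact (𝓕.tensorFil _).neg_mem hx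
  · rw [mul_zero]; exact (𝓕.tensorFil _).zero_mem
  · intro x y _ _ hx hy; rw [mul_add]; exact (𝓕.tensorFil _).add_mem hx hy
  · intro x _ hx; rw [mul_neg]; exact (𝓕.tensorFil _).neg_mem hx

theorem comulHom_aug_mem {u : UniversalEnvelopingAlgebra k L} (hu : u ∈ aug k L) :
    comulHom k u ∈ 𝓕.tensorFil 1 := by
  obtain ⟨ee, hee⟩ : ∃ ee : UniversalEnvelopingAlgebra k L ⊗[k] UniversalEnvelopingAlgebra k L →ₐ[k] k,
      ∀ a b, ee (a ⊗ₜ b) = counitHom k a * counitHom k b :=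
    ⟨Algebra.TensorProduct.lift (counitHom k (L := L)) (counitHom k (L := L))
      (fun _ _ => mul_comm _ _), fun a b => Algebra.TensorProduct.lift_tmul _ _ _ a b⟩
  have key : ∀ z, z - ee z • 1 ∈ 𝓕.tensorFil 1 := by
    intro z
    induction z with
    | zero => simp [(𝓕.tensorFil 1).zero_mem]
    | add a b ha hb =>
      have := (𝓕.tensorFil 1).add_mem ha hb
      rw [map_add, add_smul]
      convert this using 1
      abel
    | tmul a b =>
      have h : a ⊗ₜ[k] b - ee (a ⊗ₜ b) • 1 =
          (a - counitHom k a • 1) ⊗ₜ b + (counitHom k a • 1) ⊗ₜ (b - counitHom k b • 1) := by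
        simp only [hee, TensorProduct.sub_tmul,
          TensorProduct.tmul_sub, TensorProduct.tmul_smul, ← TensorProduct.smul_tmul',
          Algebra.TensorProduct.one_def, mul_smul, smul_comm (counitHom k a) (counitHom k b)]
        abel
      have h' : ∀ a : UniversalEnvelopingAlgebra k L, a - counitHom k a • 1 ∈ 𝓕.uFil 1 :=
        fun a => by
          change counitHom k (a - counitHom k a • 1) = 0
          simp
      rw [h]
      exact (𝓕.tensorFil 1).add_mem
        (𝓕.tmul_mem_tensorFil (i := 1) (j := 0) rfl (h' a) trivial)
        (𝓕.tmul_mem_tensorFil (i := 0) (j := 1) rfl trivial (h' b))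
  have he : ee.comp (comulHom k) = counitHom k :=
    algHom_ext_ι k fun l => by
      simp [-ι_apply, hee, comulHom_ι, counitHom_ι]
  have h0 : ee (comulHom k u) = 0 := (DFunLike.congr_fun he u).trans hu
  simpa [h0] using key (comulHom k u)

/-- The coproduct sends `Fⁿ` into `∑_{i+j=n} Fⁱ ⊗ Fʲ`. -/
theorem comulHom_mem_tensorFil (n : ℕ) :
    ∀ x ∈ 𝓕.uFil n, comulHom k x ∈ 𝓕.tensorFil n := by
  induction n with
  | zero =>
    intro x _
    rw [← mul_one (comulHom k x)]
    exact 𝓕.mul_mem_tensorFil_left _ (𝓕.tmul_mem_tensorFil (i := 0) (j := 0) rfl trivial trivial)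
  | succ n ih =>
    refine 𝓕.uFil_succ_le n
      (S := (𝓕.tensorFil (n + 1)).comap (comulHom k (L := L) : _ →+ _)) ?_ ?_
    · intro a ha b hb
      change comulHom k (a * b) ∈ 𝓕.tensorFil (n + 1)
      rw [map_mul]
      exact 𝓕.mul_mem_tensorFil_succ (ih a ha) (𝓕.comulHom_aug_mem hb)
    · intro a x hx b
      change comulHom k (a * ι k x * b) ∈ 𝓕.tensorFil (n + 1)
      rw [map_mul, map_mul, comulHom_ι]
      refine 𝓕.mul_mem_tensorFil_right _ (𝓕.mul_mem_tensorFil_left _ ?_)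
      exact (𝓕.tensorFil _).add_mem
        (𝓕.tmul_mem_tensorFil (i := n + 1) (j := 0) rfl (𝓕.ι_mem_uFil hx) trivial)
        (𝓕.tmul_mem_tensorFil (i := 0) (j := n + 1) (zero_add _) trivial (𝓕.ι_mem_uFil hx))

theorem map_comulHom_eq_zero {A B : Type*} [AddCommGroup A] [Module k A] [AddCommGroup B]
    [Module k B] {p n : ℕ} (hn : 2 * p - 1 ≤ n) (f : UniversalEnvelopingAlgebra k L →ₗ[k] A)
    (g : UniversalEnvelopingAlgebra k L →ₗ[k] B) (hf : ∀ x ∈ 𝓕.uFil p, f x = 0)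
    (hg : ∀ x ∈ 𝓕.uFil p, g x = 0) {x : UniversalEnvelopingAlgebra k L} (hx : x ∈ 𝓕.uFil n) :
    TensorProduct.map f g (comulHom k x) = 0 := by
  have h := 𝓕.comulHom_mem_tensorFil n x hx
  have hle : 𝓕.tensorFil n ≤ (TensorProduct.map f g).toAddMonoidHom.ker := by
    refine (AddSubgroup.closure_le _).2 ?_
    rintro _ ⟨i, j, h, x, hx, y, hy, rfl⟩
    change TensorProduct.map f g (x ⊗ₜ y) = 0
    rw [TensorProduct.map_tmul]
    rcases (by omega : p ≤ i ∨ p ≤ j) with hi | hj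
    · rw [hf x (𝓕.uFil_anti hi hx), TensorProduct.zero_tmul]
    · rw [hg y (𝓕.uFil_anti hj hy), TensorProduct.tmul_zero]
  exact hle h

end Basic

section Completion

variable {k L : Type*} [CommRing k] [LieRing L] [LieAlgebra k L] (𝓕 : LieFiltration k L)

/-- The quotient algebra `U(L)/Fᵖ`. -/
abbrev UQ (p : ℕ) : Type _ := UniversalEnvelopingAlgebra k L ⧸ 𝓕.uFil p

/-- The projection `U(L) → U(L)/Fᵖ`. -/
def toUQ (p : ℕ) : UniversalEnvelopingAlgebra k L →ₐ[k] 𝓕.UQ p :=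
  Ideal.Quotient.mkₐ k (𝓕.uFil p)

theorem toUQ_surjective (p : ℕ) : Function.Surjective (𝓕.toUQ p) :=
  Ideal.Quotient.mkₐ_surjective k _

theorem toUQ_eq_zero {p : ℕ} {x : UniversalEnvelopingAlgebra k L} :
    𝓕.toUQ p x = 0 ↔ x ∈ 𝓕.uFil p :=
  Ideal.Quotient.eq_zero_iff_mem

/-- The transition map `U(L)/F^q → U(L)/F^p` for `p ≤ q`. -/
def UQFactor {p q : ℕ} (h : p ≤ q) : 𝓕.UQ q →ₐ[k] 𝓕.UQ p :=
  Ideal.Quotient.factorₐ k (𝓕.uFil_anti h)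

theorem UQFactor_toUQ {p q : ℕ} (h : p ≤ q) (x : UniversalEnvelopingAlgebra k L) :
    𝓕.UQFactor h (𝓕.toUQ q x) = 𝓕.toUQ p x := rfl

/-- The completed enveloping algebra `Û(L) = lim_p U(L)/Fᵖ`. -/
def Uhat : Subalgebra k (∀ p, 𝓕.UQ p) where
  carrier := {u | ∀ p q (h : p ≤ q), 𝓕.UQFactor h (u q) = u p}
  mul_mem' ha hb p q h := by simp [ha p q h, hb p q h]
  add_mem' ha hb p q h := by simp [ha p q h, hb p q h]
  algebraMap_mem' r p q h := by simp

/-- The canonical map `U(L) → Û(L)`. -/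
def toUhat : UniversalEnvelopingAlgebra k L →ₐ[k] 𝓕.Uhat :=
  (AlgHom.pi 𝓕.toUQ).codRestrict 𝓕.Uhat fun _ _ _ _ => rfl

/-- The projection `Û(L) → U(L)/Fᵖ`. -/
def proj (p : ℕ) : 𝓕.Uhat →ₐ[k] 𝓕.UQ p :=
  (Pi.evalAlgHom k _ p).comp 𝓕.Uhat.val

theorem UQFactor_proj {p q : ℕ} (h : p ≤ q) (u : 𝓕.Uhat) :
    𝓕.UQFactor h (𝓕.proj q u) = 𝓕.proj p u := u.2 p q h

/-- The transition map `U(L)/F^q ⊗ U(L)/F^q → U(L)/F^p ⊗ U(L)/F^p` for `p ≤ q`. -/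
def UQ2Factor {p q : ℕ} (h : p ≤ q) : 𝓕.UQ q ⊗[k] 𝓕.UQ q →ₐ[k] 𝓕.UQ p ⊗[k] 𝓕.UQ p :=
  Algebra.TensorProduct.map (𝓕.UQFactor h) (𝓕.UQFactor h)

/-- The completed tensor product `Û(L) ⊗̂ Û(L) = lim_p U(L)/Fᵖ ⊗ U(L)/Fᵖ`. -/
def Uhat2 : Subalgebra k (∀ p, 𝓕.UQ p ⊗[k] 𝓕.UQ p) where
  carrier := {u | ∀ p q (h : p ≤ q), 𝓕.UQ2Factor h (u q) = u p}
  mul_mem' ha hb p q h := by simp [ha p q h, hb p q h]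
  add_mem' ha hb p q h := by simp [ha p q h, hb p q h]
  algebraMap_mem' r p q h := by simp [-Algebra.TensorProduct.algebraMap_apply]

/-- The canonical map `Û(L) × Û(L) → Û(L) ⊗̂ Û(L)`, `(g, h) ↦ g ⊗ h`. -/
def tmulHat (g h : 𝓕.Uhat) : 𝓕.Uhat2 :=
  ⟨fun p => 𝓕.proj p g ⊗ₜ 𝓕.proj p h, fun p q hpq => by
    change 𝓕.UQFactor hpq (𝓕.proj q g) ⊗ₜ 𝓕.UQFactor hpq (𝓕.proj q h) = _
    rw [UQFactor_proj, UQFactor_proj]⟩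

/-- The map `U(L)/F²ᵖ⁻¹ → U(L)/Fᵖ ⊗ U(L)/Fᵖ` induced by the coproduct of `U(L)`. -/
def comulUQ (p : ℕ) : 𝓕.UQ (2 * p - 1) →ₐ[k] 𝓕.UQ p ⊗[k] 𝓕.UQ p :=
  Ideal.Quotient.liftₐ (𝓕.uFil (2 * p - 1))
    ((Algebra.TensorProduct.map (𝓕.toUQ p) (𝓕.toUQ p)).comp (comulHom k))
    fun _ ha => 𝓕.map_comulHom_eq_zero le_rfl (𝓕.toUQ p).toLinearMap (𝓕.toUQ p).toLinearMap
      (fun _ => 𝓕.toUQ_eq_zero.2) (fun _ => 𝓕.toUQ_eq_zero.2) ha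

theorem comulUQ_toUQ (p : ℕ) (x : UniversalEnvelopingAlgebra k L) :
    𝓕.comulUQ p (𝓕.toUQ (2 * p - 1) x) =
      Algebra.TensorProduct.map (𝓕.toUQ p) (𝓕.toUQ p) (comulHom k x) := rfl

theorem UQ2Factor_comulUQ {p q : ℕ} (h : p ≤ q) (y : 𝓕.UQ (2 * q - 1)) :
    𝓕.UQ2Factor h (𝓕.comulUQ q y) =
      𝓕.comulUQ p (𝓕.UQFactor (by omega : 2 * p - 1 ≤ 2 * q - 1) y) := by
  obtain ⟨x, rfl⟩ := 𝓕.toUQ_surjective _ y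
  rw [UQFactor_toUQ, comulUQ_toUQ, comulUQ_toUQ]
  have : (𝓕.UQ2Factor h).comp (Algebra.TensorProduct.map (𝓕.toUQ q) (𝓕.toUQ q)) =
      Algebra.TensorProduct.map (𝓕.toUQ p) (𝓕.toUQ p) := by
    ext <;> rfl
  exact DFunLike.congr_fun this (comulHom k x)

/-- The completed coproduct `Û(L) → Û(L) ⊗̂ Û(L)`. -/
def comulHat : 𝓕.Uhat →ₐ[k] 𝓕.Uhat2 :=
  (AlgHom.pi fun p => (𝓕.comulUQ p).comp (𝓕.proj (2 * p - 1))).codRestrict 𝓕.Uhat2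
    fun u p q h => by
      change 𝓕.UQ2Factor h (𝓕.comulUQ q (𝓕.proj _ u)) = 𝓕.comulUQ p (𝓕.proj _ u)
      rw [UQ2Factor_comulUQ, UQFactor_proj]

/-- The augmentation `ε : Û(L) → k`, induced by `U(L)/F¹ → k`. -/
def counitHat : 𝓕.Uhat →ₐ[k] k :=
  (Ideal.Quotient.liftₐ (𝓕.uFil 1) (counitHom k (L := L)) fun _ h => h).comp (𝓕.proj 1)

/-- The grouplike elements `G(Û(L))`: those `g` with `Δ(g) = g ⊗ g` and `ε(g) = 1`. -/
def Grouplike : Set 𝓕.Uhat := {g | 𝓕.comulHat g = 𝓕.tmulHat g g ∧ 𝓕.counitHat g = 1}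

/-- The canonical linear map `L → Û(L)`. -/
def ιHat : L →ₗ[k] 𝓕.Uhat := 𝓕.toUhat.toLinearMap ∘ₗ ιLin k

end Completion

section Dual

variable {k L : Type*} [CommRing k] [LieRing L] [LieAlgebra k L] (𝓕 : LieFiltration k L)

/-- `Kᵖ = Hom(L_p, k)`, as a submodule of `Hom(L, k)` through the surjection `L → L_p`. -/
def Kp (p : ℕ) : Submodule k (Module.Dual k L) :=
  LinearMap.range (Module.Dual.transpose (R := k) (𝓕.toLq p : L →ₗ[k] 𝓕.Lq p))

theorem mem_Kp {p : ℕ} {f : Module.Dual k L} :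
    f ∈ 𝓕.Kp p ↔ ∀ x ∈ 𝓕.fil (p + 1), f x = 0 := by
  constructor
  · rintro ⟨g, rfl⟩ x hx
    change g (𝓕.toLq p x) = 0
    rw [𝓕.toLq_eq_zero.2 hx, map_zero]
  · intro h
    exact ⟨(𝓕.fil (p + 1)).toSubmodule.liftQ f h, LinearMap.ext fun _ => rfl⟩

theorem Kp_mono : Monotone 𝓕.Kp := fun _ _ h _ hf =>
  𝓕.mem_Kp.2 fun x hx => 𝓕.mem_Kp.1 hf x (𝓕.anti (Nat.add_le_add_right h 1) hx)

/-- `K`, the direct limit (here: the increasing union) of the `Kᵖ`. -/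
def K : Submodule k (Module.Dual k L) where
  carrier := {f | ∃ p, f ∈ 𝓕.Kp p}
  zero_mem' := ⟨0, Submodule.zero_mem _⟩
  add_mem' := by
    rintro f g ⟨p, hf⟩ ⟨q, hg⟩
    exact ⟨max p q, Submodule.add_mem _ (𝓕.Kp_mono (le_max_left p q) hf)
      (𝓕.Kp_mono (le_max_right p q) hg)⟩
  smul_mem' := by
    rintro c f ⟨p, hf⟩
    exact ⟨p, Submodule.smul_mem _ c hf⟩

/-- The quotient algebra `Uʲ(L_p) = U(L_p)/Fʲ⁺¹U(L_p)`. -/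
abbrev Uj (j p : ℕ) : Type _ := (𝓕.quot p).UQ (j + 1)

/-- The surjection `U(L) → U(L_p) → Uʲ(L_p)`. -/
def toUj (j p : ℕ) : UniversalEnvelopingAlgebra k L →ₐ[k] 𝓕.Uj j p :=
  ((𝓕.quot p).toUQ (j + 1)).comp (mapHom k (𝓕.toLq p))

theorem toUj_surjective (j p : ℕ) : Function.Surjective (𝓕.toUj j p) :=
  ((𝓕.quot p).toUQ_surjective _).comp (mapHom_surjective k _ (𝓕.toLq_surjective p))

/-- `U^c_j(Kᵖ)`, the dual of `Uʲ(L_p)`, as a submodule of `Hom(U(L), k)` through the surjection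
`U(L) → Uʲ(L_p)`. -/
def Ucj (j p : ℕ) : Submodule k (Module.Dual k (UniversalEnvelopingAlgebra k L)) :=
  LinearMap.range (Module.Dual.transpose (R := k) (𝓕.toUj j p).toLinearMap)

theorem mapHom_mem_uFil (p n : ℕ) : ∀ x ∈ 𝓕.uFil n, mapHom k (𝓕.toLq p) x ∈ (𝓕.quot p).uFil n := by
  induction n with
  | zero => exact fun _ _ => trivial
  | succ n ih =>
    refine 𝓕.uFil_succ_le n (S := ((𝓕.quot p).uFil (n + 1)).toAddSubgroup.comap
      (mapHom k (𝓕.toLq p) : _ →+ _)) (fun a ha b hb => ?_) fun a x hx b => ?_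
    · change mapHom k (𝓕.toLq p) (a * b) ∈ (𝓕.quot p).uFil (n + 1)
      rw [map_mul]
      exact (𝓕.quot p).mul_aug_le n (Ideal.mul_mem_mul (ih a ha)
        ((counitHom_mapHom k (𝓕.toLq p) b).trans hb))
    · change mapHom k (𝓕.toLq p) (a * ι k x * b) ∈ (𝓕.quot p).uFil (n + 1)
      rw [map_mul, map_mul, mapHom_ι]
      exact Ideal.IsTwoSided.mul_mem_of_left _ (Ideal.mul_mem_left _ _
        ((𝓕.quot p).ι_mem_uFil (𝓕.mem_quot.2 ⟨x, hx, rfl⟩)))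

theorem exists_mem_uFil (p n : ℕ) : ∀ y ∈ (𝓕.quot p).uFil n,
    ∃ x ∈ 𝓕.uFil n, mapHom k (𝓕.toLq p) x = y := by
  have hs := mapHom_surjective k _ (𝓕.toLq_surjective p)
  induction n with
  | zero => exact fun y _ => (hs y).imp fun x hx => ⟨trivial, hx⟩
  | succ n ih =>
    refine (𝓕.quot p).uFil_succ_le n (S := (𝓕.uFil (n + 1)).toAddSubgroup.map
      (mapHom k (𝓕.toLq p) : _ →+ _)) (fun a ha b hb => ?_) fun a x hx b => ?_
    · obtain ⟨a', ha', rfl⟩ := ih a ha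
      obtain ⟨b, rfl⟩ := hs b
      exact ⟨a' * b, 𝓕.mul_aug_le n (Ideal.mul_mem_mul ha'
        ((counitHom_mapHom k (𝓕.toLq p) b).symm.trans hb)), map_mul (mapHom k (𝓕.toLq p)) a' b⟩
    · obtain ⟨a, rfl⟩ := hs a
      obtain ⟨b, rfl⟩ := hs b
      obtain ⟨x', hx', rfl⟩ := 𝓕.mem_quot.1 hx
      refine ⟨a * ι k x' * b, Ideal.IsTwoSided.mul_mem_of_left _ (Ideal.mul_mem_left _ _
        (𝓕.ι_mem_uFil hx')), ?_⟩
      change mapHom k (𝓕.toLq p) (a * ι k x' * b) = _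
      rw [map_mul, map_mul, mapHom_ι]

theorem mem_Ucj {j p : ℕ} {f : Module.Dual k (UniversalEnvelopingAlgebra k L)} :
    f ∈ 𝓕.Ucj j p ↔ ∀ x, 𝓕.toUj j p x = 0 → f x = 0 := by
  constructor
  · rintro ⟨g, rfl⟩ x hx
    change g (𝓕.toUj j p x) = 0
    rw [hx, map_zero]
  · intro h
    let e := (𝓕.toUj j p).toLinearMap.quotKerEquivOfSurjective (𝓕.toUj_surjective j p)
    refine ⟨(LinearMap.ker (𝓕.toUj j p).toLinearMap).liftQ f h ∘ₗ e.symm.toLinearMap, ?_⟩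
    ext x
    change (LinearMap.ker (𝓕.toUj j p).toLinearMap).liftQ f h (e.symm (𝓕.toUj j p x)) = f x
    have : e.symm (𝓕.toUj j p x) = Submodule.Quotient.mk x := by
      rw [LinearEquiv.symm_apply_eq]; rfl
    rw [this]
    rfl

theorem toUj_eq_zero_of_mem {j p : ℕ} {x : UniversalEnvelopingAlgebra k L}
    (hx : x ∈ 𝓕.uFil (j + 1)) : 𝓕.toUj j p x = 0 :=
  (𝓕.quot p).toUQ_eq_zero.2 (𝓕.mapHom_mem_uFil p _ x hx)

/-- `Uᵖ(L_p) = U(L)/Fᵖ⁺¹`. -/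
theorem toUj_self_eq_zero {n : ℕ} {x : UniversalEnvelopingAlgebra k L} :
    𝓕.toUj n n x = 0 ↔ x ∈ 𝓕.uFil (n + 1) := by
  refine ⟨fun h => ?_, 𝓕.toUj_eq_zero_of_mem⟩
  obtain ⟨y, hy, hyx⟩ := 𝓕.exists_mem_uFil n (n + 1) _ ((𝓕.quot n).toUQ_eq_zero.1 h)
  let _ : LieRing (𝓕.UQ (n + 1)) := LieRing.ofAssociativeRing
  let ψ₀ : 𝓕.Lq n →ₗ⁅k⁆ 𝓕.UQ (n + 1) :=
    { (𝓕.fil (n + 1)).toSubmodule.liftQ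
        ((𝓕.toUQ (n + 1)).toLinearMap ∘ₗ ιLin k)
        (fun l hl => 𝓕.toUQ_eq_zero.2 (𝓕.ι_mem_uFil hl)) with
      map_lie' := by
        intro a b
        obtain ⟨a, rfl⟩ := 𝓕.toLq_surjective n a
        obtain ⟨b, rfl⟩ := 𝓕.toLq_surjective n b
        change 𝓕.toUQ (n + 1) (ι k ⁅a, b⁆) =
          ⁅𝓕.toUQ (n + 1) (ι k a), 𝓕.toUQ (n + 1) (ι k b)⁆
        let _ : LieRing (UniversalEnvelopingAlgebra k L) := LieRing.ofAssociativeRing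
        rw [LieHom.map_lie, LieRing.of_associative_ring_bracket,
          LieRing.of_associative_ring_bracket, map_sub, map_mul, map_mul] }
  have hψ : (lift k ψ₀).comp (mapHom k (𝓕.toLq n)) = 𝓕.toUQ (n + 1) :=
    algHom_ext_ι k fun l => by
      rw [AlgHom.comp_apply, mapHom_ι, lift_ι_apply]; rfl
  have hyx' : mapHom k (𝓕.toLq n) y = mapHom k (𝓕.toLq n) x := hyx
  rw [← 𝓕.toUQ_eq_zero] at hy ⊢
  rw [← hψ, AlgHom.comp_apply] at hy ⊢
  rw [← hyx', hy]

theorem mem_Ucj_self {n : ℕ} {f : Module.Dual k (UniversalEnvelopingAlgebra k L)} :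
    f ∈ 𝓕.Ucj n n ↔ ∀ x ∈ 𝓕.uFil (n + 1), f x = 0 := by
  simp only [mem_Ucj, toUj_self_eq_zero]

theorem Ucj_le_self (j p : ℕ) {n : ℕ} (h : j ≤ n) : 𝓕.Ucj j p ≤ 𝓕.Ucj n n := fun _ hf =>
  𝓕.mem_Ucj_self.2 fun x hx => 𝓕.mem_Ucj.1 hf x
    (𝓕.toUj_eq_zero_of_mem (𝓕.uFil_anti (Nat.add_le_add_right h 1) hx))

/-- The algebra `U^c(K)`: the direct limit (here: the directed union over `j, p`) of the
`U^c_j(Kᵖ)`, inside the algebra of linear functionals on `U(L)` whose product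
`(f g)(x) = (f ⊗ g)(Δ x)` (the shuffle product) is dual to the coproduct of `U(L)` and whose unit
is the counit of `U(L)`. -/
def Uc : Subalgebra k (WithConv (Module.Dual k (UniversalEnvelopingAlgebra k L))) where
  carrier := {f | ∃ j p, f.ofConv ∈ 𝓕.Ucj j p}
  add_mem' := by
    rintro f g ⟨j, p, hf⟩ ⟨j', p', hg⟩
    exact ⟨max j j', max j j', Submodule.add_mem _ (𝓕.Ucj_le_self j p (le_max_left _ _) hf)
      (𝓕.Ucj_le_self j' p' (le_max_right _ _) hg)⟩
  mul_mem' := by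
    rintro f g ⟨j, p, hf⟩ ⟨j', p', hg⟩
    have hf' := 𝓕.mem_Ucj_self.1 (𝓕.Ucj_le_self j p (le_max_left j j') hf)
    have hg' := 𝓕.mem_Ucj_self.1 (𝓕.Ucj_le_self j' p' (le_max_right j j') hg)
    refine ⟨2 * max j j', 2 * max j j', 𝓕.mem_Ucj_self.2 fun x hx => ?_⟩
    rw [show (f * g).ofConv x = LinearMap.mul' k k
      (TensorProduct.map f.ofConv g.ofConv (comulHom k x)) from rfl,
      𝓕.map_comulHom_eq_zero (by omega) f.ofConv g.ofConv hf' hg' hx, map_zero]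
  algebraMap_mem' := by
    intro r
    refine ⟨0, 0, 𝓕.mem_Ucj_self.2 fun x hx => ?_⟩
    rw [LinearMap.convAlgebraMap_apply, counit_eq, show counitHom k x = 0 from hx]
    simp

theorem mem_Uc {f : WithConv (Module.Dual k (UniversalEnvelopingAlgebra k L))} :
    f ∈ 𝓕.Uc ↔ ∃ n, ∀ x ∈ 𝓕.uFil n, f x = 0 := by
  constructor
  · rintro ⟨j, p, hf⟩
    exact ⟨j + 1, 𝓕.mem_Ucj_self.1 (𝓕.Ucj_le_self j p le_rfl hf)⟩
  · rintro ⟨n, hf⟩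
    exact ⟨n, n, 𝓕.mem_Ucj_self.2 fun x hx => hf x (𝓕.uFil_anti (Nat.le_succ n) hx)⟩

/-- The counit `ε : U^c(K) → k`, dual to the unit of `U(L)`. -/
def counitUc : Module.Dual k 𝓕.Uc where
  toFun f := f.1 1
  map_add' _ _ := rfl
  map_smul' _ _ := rfl

/-- The natural projection `φ : U^c(K) → K`, dual to `L → U(L)`. -/
def ucToK : 𝓕.Uc →ₗ[k] 𝓕.K where
  toFun f := ⟨f.1.ofConv ∘ₗ ιLin k, by
    obtain ⟨n, hn⟩ := 𝓕.mem_Uc.1 f.2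
    exact ⟨n, 𝓕.mem_Kp.2 fun x hx => hn _ (𝓕.ι_mem_uFil (𝓕.anti (Nat.le_succ n) hx))⟩⟩
  map_add' _ _ := rfl
  map_smul' _ _ := rfl

/-- The infinitesimal characters of `U^c(K)`: linear maps `α : U^c(K) → k` with
`α(uv) = ε(u) α(v) + α(u) ε(v)`. -/
def HomInf : Submodule k (Module.Dual k 𝓕.Uc) where
  carrier := {α | ∀ u v, α (u * v) = 𝓕.counitUc u * α v + α u * 𝓕.counitUc v}
  zero_mem' u v := by simp
  add_mem' {α β} hα hβ u v := by
    simp only [LinearMap.add_apply, hα u v, hβ u v]; ring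
  smul_mem' c α hα u v := by
    simp only [LinearMap.smul_apply, hα u v, smul_eq_mul]; ring

/-- A functional on `U(L)` which vanishes on `Fⁿ`, as a functional on `U(L)/Fⁿ`. -/
def liftUQ {n : ℕ} (f : Module.Dual k (UniversalEnvelopingAlgebra k L))
    (hf : ∀ x ∈ 𝓕.uFil n, f x = 0) : Module.Dual k (𝓕.UQ n) :=
  ((𝓕.uFil n).restrictScalars k).liftQ f hf ∘ₗ
    (Submodule.Quotient.restrictScalarsEquiv k (𝓕.uFil n)).symm.toLinearMap

theorem liftUQ_toUQ {n : ℕ} (f : Module.Dual k (UniversalEnvelopingAlgebra k L))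
    (hf : ∀ x ∈ 𝓕.uFil n, f x = 0) (x : UniversalEnvelopingAlgebra k L) :
    𝓕.liftUQ f hf (𝓕.toUQ n x) = f x := rfl

theorem liftUQ_proj_eq {m n : ℕ} (f : Module.Dual k (UniversalEnvelopingAlgebra k L))
    (hm : ∀ x ∈ 𝓕.uFil m, f x = 0) (hn : ∀ x ∈ 𝓕.uFil n, f x = 0) (u : 𝓕.Uhat) :
    𝓕.liftUQ f hm (𝓕.proj m u) = 𝓕.liftUQ f hn (𝓕.proj n u) := by
  obtain ⟨x, hx⟩ := 𝓕.toUQ_surjective _ (𝓕.proj (max m n) u)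
  rw [← 𝓕.UQFactor_proj (le_max_left m n), ← 𝓕.UQFactor_proj (le_max_right m n), ← hx,
    UQFactor_toUQ, UQFactor_toUQ, liftUQ_toUQ, liftUQ_toUQ]

/-- The pairing of `Û(L)` with `U^c(K)`: if the functional `f` on `U(L)` vanishes on `Fⁿ`, then
`⟨u, f⟩` is the value on the `n`-th component `uₙ ∈ U(L)/Fⁿ` of the functional induced by `f`
(this does not depend on `n`, see `pairing_eq`). -/
def pairing (u : 𝓕.Uhat) (f : 𝓕.Uc) : k :=
  𝓕.liftUQ f.1.ofConv (𝓕.mem_Uc.1 f.2).choose_spec (𝓕.proj (𝓕.mem_Uc.1 f.2).choose u)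

theorem pairing_eq {n : ℕ} (u : 𝓕.Uhat) (f : 𝓕.Uc) (hf : ∀ x ∈ 𝓕.uFil n, f.1.ofConv x = 0) :
    𝓕.pairing u f = 𝓕.liftUQ f.1.ofConv hf (𝓕.proj n u) :=
  𝓕.liftUQ_proj_eq _ _ _ u

/-- The duality map `Û(L) → Hom(U^c(K), k)`. -/
def duality : 𝓕.Uhat →ₗ[k] Module.Dual k 𝓕.Uc where
  toFun u :=
    { toFun := 𝓕.pairing u
      map_add' := by
        intro f g
        obtain ⟨m, hm⟩ := 𝓕.mem_Uc.1 f.2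
        obtain ⟨n, hn⟩ := 𝓕.mem_Uc.1 g.2
        have hm' : ∀ x ∈ 𝓕.uFil (max m n), f.1.ofConv x = 0 :=
          fun x hx => hm x (𝓕.uFil_anti (le_max_left m n) hx)
        have hn' : ∀ x ∈ 𝓕.uFil (max m n), g.1.ofConv x = 0 :=
          fun x hx => hn x (𝓕.uFil_anti (le_max_right m n) hx)
        have hs : ∀ x ∈ 𝓕.uFil (max m n), (f + g).1.ofConv x = 0 := fun x hx => by
          change f.1.ofConv x + g.1.ofConv x = 0
          rw [hm' x hx, hn' x hx, add_zero]
        rw [𝓕.pairing_eq u f hm', 𝓕.pairing_eq u g hn', 𝓕.pairing_eq u (f + g) hs]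
        obtain ⟨x, hx⟩ := 𝓕.toUQ_surjective _ (𝓕.proj (max m n) u)
        rw [← hx, liftUQ_toUQ, liftUQ_toUQ, liftUQ_toUQ]
        rfl
      map_smul' := by
        intro c f
        obtain ⟨m, hm⟩ := 𝓕.mem_Uc.1 f.2
        have hs : ∀ x ∈ 𝓕.uFil m, (c • f).1.ofConv x = 0 := fun x hx => by
          change c • f.1.ofConv x = 0
          rw [hm x hx, smul_zero]
        rw [𝓕.pairing_eq u f hm, 𝓕.pairing_eq u (c • f) hs]
        obtain ⟨x, hx⟩ := 𝓕.toUQ_surjective _ (𝓕.proj m u)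
        rw [← hx, liftUQ_toUQ, liftUQ_toUQ]
        rfl }
  map_add' u v := by
    ext f
    simp only [LinearMap.coe_mk, AddHom.coe_mk, LinearMap.add_apply, pairing, map_add]
  map_smul' c u := by
    ext f
    simp only [LinearMap.coe_mk, AddHom.coe_mk, LinearMap.smul_apply, pairing, map_smul,
      RingHom.id_apply]

end Dual

end LieFiltration

end

/-! Everything rests on duality at finite level. Each `U(L)/Fⁿ` is finite dimensional, because
modulo `Fⁿ⁺¹` the algebra is spanned by `1` and by products of finitely many elements spanning it
modulo `Fⁿ` with finitely many elements of `L`. Since `U^c(K)` is the union of the duals of these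
quotients, `Û(L)` is its full linear dual. The product of `U^c(K)` is dual to `Δ` and its unit to
`ε`, and pure tensors of functionals separate points of a tensor product; hence grouplike elements
correspond to characters (`mem_grouplike_iff`). The isomorphism of `L` with the dual of `K` is the
same double duality for the `L_p`, combined with completeness.

What remains is that every infinitesimal character factors uniquely through `φ`. Two facts carry
this, both proved without a basis of `U(L)`.

Uniqueness needs `φ` surjective, which follows from injectivity of `L/Lⁿ → U(L)/Fⁿ`
(`ι_mem_uFil_iff`). This is proved by induction on `dim L/Lⁿ`: for an ideal `H` of codimension one
and `y` outside it, `L` acts on `U(H)` with `H` multiplying and `y` acting as a derivation, and this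
action respects weights.

Existence needs primitive elements of `Û(L)` to come from `L`. The second Adams operation `ψ = mult
∘ Δ` multiplies words of length `d` by `2ᵈ` modulo shorter words, while a primitive element
satisfies `ψ(u) = 2u`. In characteristic zero `2ᵈ ≠ 2` for `d ≥ 2`, so such an element reduces to
length at most one (`exists_sub_ι_mem_of_adamsSq_sub_mem`). This is carried out modulo powers of the
augmentation ideal of `U(L_n)`; the resulting approximations in `L` are glued by injectivity and
completeness. -/

noncomputable section

attribute [local instance 100] LieRing.ofAssociativeRing

namespace UniversalEnvelopingAlgebra

/-! ### Derivations of enveloping algebras -/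

section Derivation

variable {k L : Type*} [CommRing k] [LieRing L] [LieAlgebra k L]

/-- A derivation of a Lie algebra extends to its enveloping algebra. -/
theorem exists_derivation_extending (D : L →ₗ[k] L) (hD : ∀ a b, D ⁅a, b⁆ = ⁅D a, b⁆ + ⁅a, D b⁆) :
    ∃ δ : UniversalEnvelopingAlgebra k L →ₗ[k] UniversalEnvelopingAlgebra k L,
      (∀ a b, δ (a * b) = δ a * b + a * δ b) ∧ ∀ x, δ (ι k x) = ι k (D x) := by
  -- The map `x ↦ x + D(x)ε` respects brackets because `D` is a derivation; the `ε`-part of its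
  -- extension to `U(L)` is the required `δ`.
  let f : L →ₗ⁅k⁆ DualNumber (UniversalEnvelopingAlgebra k L) :=
    { toFun := fun x => TrivSqZeroExt.inl (ι k x) + TrivSqZeroExt.inr (ι k (D x))
      map_add' := fun a b => by
        ext <;> simp [-ι_apply]
      map_smul' := fun c a => by
        ext <;> simp [-ι_apply]
      map_lie' := fun {a b} => by
        ext <;> simp [-ι_apply, LieRing.of_associative_ring_bracket, hD]
        abel }
  have hfst : (TrivSqZeroExt.fstHom k (UniversalEnvelopingAlgebra k L) _).comp (lift k f) =
      AlgHom.id k _ :=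
    algHom_ext_ι k fun l => by
      rw [AlgHom.comp_apply, lift_ι_apply]
      simp [-ι_apply, f]
  have hfst' : ∀ a, (lift k f a).fst = a := DFunLike.congr_fun hfst
  refine ⟨{ toFun := fun a => (lift k f a).snd, map_add' := ?_, map_smul' := ?_ }, ?_, ?_⟩
  · intro a b; simp
  · intro c a; simp
  · intro a b
    change (lift k f (a * b)).snd = (lift k f a).snd * b + a * (lift k f b).snd
    rw [map_mul, DualNumber.snd_mul, hfst', hfst', add_comm]
  · intro x
    change (lift k f (ι k x)).snd = _
    rw [lift_ι_apply]
    simp [-ι_apply, f]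

end Derivation

end UniversalEnvelopingAlgebra

namespace LieFiltration

open UniversalEnvelopingAlgebra

/-! ### The weight filtration of `U(L)` -/

section Words

variable {k L : Type*} [CommRing k] [LieRing L] [LieAlgebra k L] (𝓕 : LieFiltration k L)

theorem fil_zero : 𝓕.fil 0 = ⊤ :=
  top_le_iff.1 (𝓕.fil_one ▸ 𝓕.anti zero_le_one)

/-- `𝓕.IsWord n w` says that `w = x₁ ⋯ xᵣ` with `xᵢ ∈ L^{aᵢ}` and `∑ aᵢ = n`. -/
inductive IsWord : ℕ → UniversalEnvelopingAlgebra k L → Prop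
  | one : IsWord 0 1
  | ι_mul {i n : ℕ} {x : L} {w : UniversalEnvelopingAlgebra k L} (hx : x ∈ 𝓕.fil i)
      (hw : IsWord n w) : IsWord (i + n) (ι k x * w)

/-- The multiplicative decreasing filtration of `U(L)` by the weight of words. -/
def wordFil (n : ℕ) : Submodule k (UniversalEnvelopingAlgebra k L) :=
  Submodule.span k {w | 𝓕.IsWord n w}

variable {𝓕} in
theorem IsWord.mul {m n : ℕ} {v w : UniversalEnvelopingAlgebra k L} (hv : 𝓕.IsWord m v)
    (hw : 𝓕.IsWord n w) : 𝓕.IsWord (m + n) (v * w) := by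
  induction hv with
  | one => simpa using hw
  | ι_mul hx _ ih => rw [add_assoc, mul_assoc]; exact .ι_mul hx ih

variable {𝓕} in
theorem IsWord.mem {n : ℕ} {w : UniversalEnvelopingAlgebra k L} (hw : 𝓕.IsWord n w) :
    w ∈ 𝓕.wordFil n := Submodule.subset_span hw

theorem wordFil_le {n : ℕ} {S : Submodule k (UniversalEnvelopingAlgebra k L)}
    (h : ∀ w, 𝓕.IsWord n w → w ∈ S) : 𝓕.wordFil n ≤ S := Submodule.span_le.2 h

theorem wordFil_anti : Antitone 𝓕.wordFil := by
  refine antitone_nat_of_succ_le fun n => 𝓕.wordFil_le fun w hw => ?_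
  obtain ⟨m, hm⟩ : ∃ m, m = n + 1 := ⟨_, rfl⟩
  rw [← hm] at hw
  induction hw generalizing n with
  | one => omega
  | @ι_mul i m x w hx hw ih =>
    -- A first letter of positive weight also counts with weight one less. If its weight is `0`, the
    -- loss has to come from the remaining word, by induction.
    cases i with
    | zero =>
      have := Submodule.mul_mem_mul
        (Submodule.mem_span_singleton_self (R := k) (ι k x)) (ih n (by omega))
      rw [wordFil, Submodule.span_mul_span] at this
      refine Submodule.span_mono ?_ this
      rintro _ ⟨_, rfl, w, hw, rfl⟩
      exact (zero_add n) ▸ IsWord.ι_mul hx hw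
    | succ i =>
      rw [show n = i + m by omega]
      exact (IsWord.ι_mul (𝓕.anti (Nat.le_succ i) hx) hw).mem

theorem mul_mem_wordFil {m n : ℕ} {a b : UniversalEnvelopingAlgebra k L}
    (ha : a ∈ 𝓕.wordFil m) (hb : b ∈ 𝓕.wordFil n) : a * b ∈ 𝓕.wordFil (m + n) := by
  have := Submodule.mul_mem_mul ha hb
  rw [wordFil, wordFil, Submodule.span_mul_span] at this
  refine Submodule.span_mono ?_ this
  rintro _ ⟨v, hv, w, hw, rfl⟩
  exact IsWord.mul hv hw

theorem ι_mem_wordFil {n : ℕ} {x : L} (hx : x ∈ 𝓕.fil n) : ι k x ∈ 𝓕.wordFil n := by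
  have := (IsWord.ι_mul hx IsWord.one).mem
  rwa [mul_one, add_zero] at this

theorem mem_wordFil_zero (a : UniversalEnvelopingAlgebra k L) : a ∈ 𝓕.wordFil 0 := by
  let S : Subalgebra k (UniversalEnvelopingAlgebra k L) :=
    (𝓕.wordFil 0).toSubalgebra IsWord.one.mem fun a b ha hb =>
      𝓕.mul_mem_wordFil (m := 0) (n := 0) ha hb
  exact induction_ι k (S := S) (fun l => 𝓕.ι_mem_wordFil (𝓕.fil_zero ▸ trivial)) a

/-- The sum `k + U(L)·L` is a subalgebra containing `L`, hence is everything; the counit kills the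
second summand and so forces the scalar part to vanish. -/
theorem mem_top_mul_range_of_mem_aug {b : UniversalEnvelopingAlgebra k L} (hb : b ∈ aug k L) :
    b ∈ (⊤ : Submodule k (UniversalEnvelopingAlgebra k L)) * LinearMap.range (ιLin k) := by
  set X := LinearMap.range (ιLin k (L := L)) with hX
  let S : Subalgebra k (UniversalEnvelopingAlgebra k L) :=
    (1 ⊔ ⊤ * X).toSubalgebra (Submodule.mem_sup_left (Submodule.one_le.1 le_rfl)) fun a b ha hb => by
      have h : (1 ⊔ ⊤ * X) * (1 ⊔ ⊤ * X) ≤ 1 ⊔ ⊤ * X := by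
        rw [Submodule.mul_sup, mul_one, ← mul_assoc]
        exact sup_le le_rfl (le_sup_of_le_right (mul_le_mul_left le_top _))
      exact h (Submodule.mul_mem_mul ha hb)
  have hS : b ∈ (1 ⊔ ⊤ * X : Submodule k _) := induction_ι k (S := S) (fun l => by
    refine Submodule.mem_sup_right ?_
    rw [← one_mul (ι k l)]
    exact Submodule.mul_mem_mul trivial ⟨l, rfl⟩) b
  obtain ⟨c, hc, d, hd, rfl⟩ := Submodule.mem_sup.1 hS
  obtain ⟨r, rfl⟩ := Submodule.mem_one.1 hc
  have hd0 : counitHom k d = 0 := by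
    refine Submodule.mul_induction_on hd (fun m _ n hn => ?_) fun x y hx hy => ?_
    · obtain ⟨l, rfl⟩ := hn
      rw [map_mul, ιLin_apply, counitHom_ι, mul_zero]
    · rw [map_add, hx, hy, add_zero]
  have hr : r = 0 := by
    have : counitHom k (algebraMap k _ r + d) = 0 := hb
    simpa [hd0] using this
  simpa [hr] using hd

/-- Allows `F` to be replaced by the weight filtration, which is multiplicative. In general `Fⁱ·Fʲ`
need not lie in `Fⁱ⁺ʲ`; only this inclusion is needed for injectivity. -/
theorem uFil_le_wordFil (n : ℕ) : ∀ a ∈ 𝓕.uFil n, a ∈ 𝓕.wordFil n := by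
  induction n with
  | zero => exact fun a _ => 𝓕.mem_wordFil_zero a
  | succ n ih =>
    refine 𝓕.uFil_succ_le n (S := (𝓕.wordFil (n + 1)).toAddSubgroup) (fun a ha b hb => ?_)
      fun a x hx b => ?_
    · change a * b ∈ 𝓕.wordFil (n + 1)
      refine Submodule.mul_induction_on (mem_top_mul_range_of_mem_aug hb) (fun c _ d hd => ?_)
        fun x y hx hy => ?_
      · obtain ⟨l, rfl⟩ := hd
        rw [← mul_assoc]
        exact 𝓕.mul_mem_wordFil (m := n + 0) (𝓕.mul_mem_wordFil (ih a ha) (𝓕.mem_wordFil_zero c))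
          (𝓕.ι_mem_wordFil (𝓕.fil_one ▸ trivial))
      · rw [mul_add]; exact add_mem hx hy
    · have := 𝓕.mul_mem_wordFil (𝓕.mul_mem_wordFil (𝓕.mem_wordFil_zero a) (𝓕.ι_mem_wordFil hx))
        (𝓕.mem_wordFil_zero b)
      rwa [zero_add, add_zero] at this

/-- The filtration induced on an ideal. -/
def restrict (H : LieIdeal k L) : LieFiltration k H where
  fil i := (𝓕.fil i).comap (LieIdeal.incl H)
  fil_one := by
    refine eq_top_iff.2 fun x _ => ?_
    rw [LieIdeal.mem_comap, 𝓕.fil_one]; trivial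
  anti i j h := LieIdeal.comap_mono (𝓕.anti h)
  lie_mem i j x hx y hy := by
    rw [LieIdeal.mem_comap] at *
    rw [LieHom.map_lie]
    exact 𝓕.lie_mem i j _ hx _ hy

theorem mem_restrict {H : LieIdeal k L} {i : ℕ} {x : H} :
    x ∈ (𝓕.restrict H).fil i ↔ (x : L) ∈ 𝓕.fil i := Iff.rfl

end Words

/-! ### Injectivity of `L/Lⁿ → U(L)/Fⁿ` -/

section Injectivity

variable {k L : Type*} [Field k] [LieRing L] [LieAlgebra k L] (𝓕 : LieFiltration k L)

/-- A linear functional which vanishes on brackets kills every `x ∈ L` whose image in `U(L)` has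
larger weight than that on which the functional is nonzero. -/
theorem apply_eq_zero_of_ι_mem_wordFil {c n : ℕ} (hcn : c < n) (φ : L →ₗ[k] k)
    (hφ : ∀ a b : L, φ ⁅a, b⁆ = 0) (hφc : ∀ x ∈ 𝓕.fil (c + 1), φ x = 0) {x : L}
    (hx : ι k x ∈ 𝓕.wordFil n) : φ x = 0 := by
  let f : L →ₗ⁅k⁆ DualNumber k :=
    { TrivSqZeroExt.inrHom k k ∘ₗ φ with
      map_lie' := fun {a b} => by
        simp [hφ, LieRing.of_associative_ring_bracket] }
  have hf : ∀ x, f x = TrivSqZeroExt.inr (φ x) := fun _ => rfl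
  have h1 : ∀ m w, 𝓕.IsWord m w → 1 ≤ m → (lift k f w).fst = 0 := by
    intro m w hw hm
    cases hw with
    | one => omega
    | ι_mul hx _ => rw [map_mul, lift_ι_apply, hf]; simp
  have h2 : ∀ m w, 𝓕.IsWord m w → c < m → lift k f w = 0 := by
    intro m w hw hm
    cases hw with
    | one => omega
    | @ι_mul i m x w hx hw =>
      rw [map_mul, lift_ι_apply, hf]
      -- Either the first letter has weight above `c` and is killed by `φ`, or the remaining word
      -- has positive weight, hence is nonempty and has no constant part; then `ε² = 0` kills the
      -- product.
      by_cases hi : c + 1 ≤ i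
      · rw [hφc x (𝓕.anti hi hx), TrivSqZeroExt.inr_zero, zero_mul]
      · ext <;> simp [h1 m w hw (by omega)]
  have h3 := 𝓕.wordFil_le (n := n) (S := LinearMap.ker (lift k f).toLinearMap)
    (fun w hw => h2 n w hw hcn) hx
  have h4 : lift k f (ι k x) = 0 := h3
  rw [lift_ι_apply, hf] at h4
  simpa using congrArg TrivSqZeroExt.snd h4

/-- The enveloping algebra of an ideal `H` with `L = H + k y` is a module over `L`, where `H` acts
by left multiplication and `y` as a derivation; this detects the filtration. -/
theorem mem_fil_of_hyperplane {c n : ℕ} (hc1 : 1 ≤ c) (hcn : c < n) (hc : 𝓕.fil c = ⊤)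
    (φ : L →ₗ[k] k) (hφc : ∀ x ∈ 𝓕.fil (c + 1), φ x = 0) {y : L} (hy : φ y = 1)
    (H : LieIdeal k L) (hH : ∀ x, x ∈ H ↔ φ x = 0)
    (ih : ∀ x : H, ι k x ∈ (𝓕.restrict H).wordFil n → x ∈ (𝓕.restrict H).fil n)
    {x : L} (hx : ι k x ∈ 𝓕.wordFil n) : x ∈ 𝓕.fil n := by
  have hφ : ∀ a b : L, φ ⁅a, b⁆ = 0 := fun a b =>
    hφc _ (𝓕.anti (by omega) (𝓕.lie_mem c c a (hc ▸ trivial) b (hc ▸ trivial)))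
  let π : L →ₗ[k] H :=
    (LinearMap.id - φ.smulRight y).codRestrict H.toSubmodule fun z => by
      change _ ∈ H
      simp [hH, hy]
  have hπ : ∀ z, (π z : L) = z - φ z • y := fun _ => rfl
  let D : H →ₗ[k] H := LieModule.toEnd k L H y
  obtain ⟨δ, hδ, hδι⟩ := exists_derivation_extending D fun a b => by
    ext1
    change ⁅y, ⁅(a : L), (b : L)⁆⁆ = ⁅⁅y, (a : L)⁆, (b : L)⁆ + ⁅(a : L), ⁅y, (b : L)⁆⁆
    exact leibniz_lie _ _ _
  have hδ1 : δ 1 = 0 := by simpa using hδ 1 1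
  -- Writing `z = π z + φ(z) y`, the action of `z` on `U(H)` is left multiplication by `π z` plus
  -- `φ(z)` times the derivation extending `ad y`.
  let ρ : L →ₗ⁅k⁆ Module.End k (UniversalEnvelopingAlgebra k H) :=
    { LinearMap.mul k _ ∘ₗ ιLin k ∘ₗ π + φ.smulRight δ with
      map_lie' := fun {a b} => by
        have e : π ⁅a, b⁆ = ⁅π a, π b⁆ + φ a • D (π b) - φ b • D (π a) := by
          ext1
          change (π ⁅a, b⁆ : L) = ⁅(π a : L), (π b : L)⁆ + φ a • ⁅y, (π b : L)⁆
            - φ b • ⁅y, (π a : L)⁆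
          simp only [hπ, hφ, lie_sub, sub_lie, lie_smul, smul_lie, lie_self, smul_sub, zero_smul]
          rw [← lie_skew a y, smul_neg]
          simp only [smul_zero, sub_zero]
          abel
        ext w
        simp [LieRing.of_associative_ring_bracket, hφ, e, -ι_apply, ιLin_apply, hδ, hδι]
        have e' : ι k ⁅(π a : L), π b⁆ = ι k (π a) * ι k (π b) - ι k (π b) * ι k (π a) :=
          ((ι k).map_lie (π a) (π b)).trans (LieRing.of_associative_ring_bracket _ _)
        rw [e', smul_comm (φ b) (φ a)]
        simp only [mul_add, sub_mul, mul_smul_comm, mul_assoc]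
        abel }
  have hρ : ∀ z w, ρ z w = ι k (π z) * w + φ z • δ w := fun _ _ => rfl
  -- Since `Lᶜ = L`, the element `y` has weight `c`, so `ad y` and its extension `δ` raise weights
  -- by `c`.
  have hδw : ∀ m w, (𝓕.restrict H).IsWord m w → δ w ∈ (𝓕.restrict H).wordFil (m + c) := by
    intro m w hw
    induction hw with
    | one => rw [hδ1]; exact zero_mem _
    | @ι_mul i m x w hx hw ih =>
      rw [hδ, hδι]
      refine add_mem ?_ ?_
      · have : D x ∈ (𝓕.restrict H).fil (c + i) :=
          𝓕.lie_mem c i y (hc ▸ trivial) x hx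
        convert (IsWord.ι_mul this hw).mem using 1
        ring_nf
      · rw [add_assoc]
        exact mul_mem_wordFil _ (ι_mem_wordFil _ hx) ih
  have hδm : ∀ m, ∀ w ∈ (𝓕.restrict H).wordFil m, δ w ∈ (𝓕.restrict H).wordFil (m + c) :=
    fun m w hw => wordFil_le _ (S := ((𝓕.restrict H).wordFil (m + c)).comap δ) (hδw m) hw
  have hρm : ∀ i z, z ∈ 𝓕.fil i → ∀ m, ∀ w ∈ (𝓕.restrict H).wordFil m,
      ρ z w ∈ (𝓕.restrict H).wordFil (i + m) := by
    intro i z hz m w hw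
    rw [hρ]
    -- Above weight `c` the derivation part is absent. Otherwise `i ≤ c`, and both terms raise the
    -- weight by `c`, which is enough.
    by_cases hi : c + 1 ≤ i
    · have h0 : φ z = 0 := hφc z (𝓕.anti hi hz)
      rw [h0, zero_smul, add_zero]
      refine mul_mem_wordFil _ (ι_mem_wordFil _ ?_) hw
      rw [mem_restrict, hπ, h0, zero_smul, sub_zero]
      exact hz
    · refine (𝓕.restrict H).wordFil_anti (by omega : i + m ≤ m + c) (add_mem ?_ (Submodule.smul_mem _ _ (hδm m w hw)))
      rw [add_comm]
      refine mul_mem_wordFil _ (ι_mem_wordFil _ ?_) hw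
      rw [mem_restrict, hc]
      trivial
  have hρw : ∀ m w, 𝓕.IsWord m w → lift k ρ w 1 ∈ (𝓕.restrict H).wordFil m := by
    intro m w hw
    induction hw with
    | one => rw [map_one (lift k ρ)]; exact IsWord.one.mem
    | ι_mul hx hw ih =>
      rw [map_mul, lift_ι_apply]
      exact hρm _ _ hx _ _ ih
  have key : lift k ρ (ι k x) 1 ∈ (𝓕.restrict H).wordFil n :=
    𝓕.wordFil_le (S := ((𝓕.restrict H).wordFil n).comap
      ((LinearMap.applyₗ 1) ∘ₗ (lift k ρ).toLinearMap)) (hρw n) hx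
  have hx0 := 𝓕.apply_eq_zero_of_ι_mem_wordFil hcn φ hφ hφc hx
  -- Acting on `1`, where `δ` vanishes, recovers `π x` as an element of weight `n` in `U(H)`; since
  -- `φ x = 0`, this is `x` itself.
  rw [lift_ι_apply, hρ, hδ1, smul_zero, add_zero, mul_one] at key
  have := ih _ key
  rwa [mem_restrict, hπ, hx0, zero_smul, sub_zero] at this

/-- Induction on `dim L/Lⁿ`, passing to the kernel of a functional on the first nontrivial layer of
the filtration. -/
theorem mem_fil_of_ι_mem_wordFil {n : ℕ} (hfin : FiniteDimensional k (L ⧸ 𝓕.fil n)) {x : L}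
    (hx : ι k x ∈ 𝓕.wordFil n) : x ∈ 𝓕.fil n := by
  obtain ⟨N, hN⟩ : ∃ N, Module.finrank k (L ⧸ 𝓕.fil n) = N := ⟨_, rfl⟩
  induction N using Nat.strong_induction_on generalizing L with
  | _ N ihN =>
    by_cases hn : 𝓕.fil n = ⊤
    · rw [hn]; trivial
    -- `c` is the last index with `Lᶜ = L`. As `c ≥ 1`, brackets lie in `L²ᶜ ⊆ Lᶜ⁺¹`, so every
    -- functional vanishing on `Lᶜ⁺¹` kills them and its kernel is an ideal.
    obtain ⟨c, hc1, hcn, hc, hc'⟩ : ∃ c, 1 ≤ c ∧ c < n ∧ 𝓕.fil c = ⊤ ∧ 𝓕.fil (c + 1) ≠ ⊤ := by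
      classical
      have hex : ∃ m, 𝓕.fil m ≠ ⊤ := ⟨n, hn⟩
      have h1 := Nat.find_spec hex
      have h2 := Nat.find_min' hex hn
      have h0 : Nat.find hex ≠ 0 := fun h => by rw [h] at h1; exact h1 𝓕.fil_zero
      have h01 : Nat.find hex ≠ 1 := fun h => by rw [h] at h1; exact h1 𝓕.fil_one
      refine ⟨Nat.find hex - 1, by omega, by omega, ?_, ?_⟩
      · exact not_not.1 (Nat.find_min hex (m := Nat.find hex - 1) (by omega))
      · rwa [Nat.sub_add_cancel (by omega)]
    obtain ⟨φ, hφ0, hφc⟩ := Submodule.exists_le_ker_of_lt_top (𝓕.fil (c + 1)).toSubmodule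
      (lt_top_iff_ne_top.2 fun h => hc' (by simpa using h))
    obtain ⟨y, hy⟩ : ∃ y, φ y = 1 := LinearMap.surjective hφ0 1
    have hφ : ∀ a b : L, φ ⁅a, b⁆ = 0 := fun a b =>
      hφc (𝓕.anti (by omega) (𝓕.lie_mem c c a (hc ▸ trivial) b (hc ▸ trivial)))
    let H : LieIdeal k L := { LinearMap.ker φ with lie_mem := fun {a b} _ => hφ a b }
    have hH : ∀ x, x ∈ H ↔ φ x = 0 := fun _ => Iff.rfl
    let j : (H ⧸ (𝓕.restrict H).fil n) →ₗ[k] (L ⧸ 𝓕.fil n) :=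
      Submodule.mapQ ((𝓕.restrict H).fil n).toSubmodule (𝓕.fil n).toSubmodule
        (H.toSubmodule.subtype) fun _ h => h
    have hj : Function.Injective j := by
      refine (injective_iff_map_eq_zero j).2 fun a ha => ?_
      obtain ⟨a, rfl⟩ := Submodule.Quotient.mk_surjective _ a
      exact (Submodule.Quotient.mk_eq_zero _).2 ((Submodule.Quotient.mk_eq_zero (𝓕.fil n).toSubmodule
        (x := (a : L))).1 ha)
    -- The class of `y` is missed: `φ` vanishes on `H` and on `Lⁿ ⊆ Lᶜ⁺¹`, but `φ y = 1`. Hence the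
    -- dimension drops.
    have hjs : LinearMap.range j < ⊤ := by
      refine lt_top_iff_ne_top.2 fun h => ?_
      obtain ⟨a, ha⟩ : (Submodule.Quotient.mk y : L ⧸ 𝓕.fil n) ∈ LinearMap.range j := h ▸ trivial
      obtain ⟨a, rfl⟩ := Submodule.Quotient.mk_surjective _ a
      have h1 : (a : L) - y ∈ 𝓕.fil n := (Submodule.Quotient.eq _).1 ha
      have h2 : φ ((a : L) - y) = 0 := hφc (𝓕.anti (by omega) h1)
      rw [map_sub, (hH a).1 a.2, hy] at h2
      simp at h2
    refine 𝓕.mem_fil_of_hyperplane hc1 hcn hc φ (fun x hx => hφc hx) hy H hH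
      (fun x hx => ?_) hx
    refine ihN _ ?_ (𝓕.restrict H) (FiniteDimensional.of_injective j hj) hx rfl
    rw [← hN, ← LinearMap.finrank_range_of_inj hj]
    exact Submodule.finrank_lt hjs.ne

/-- The canonical map `L / Lⁿ → U(L) / Fⁿ` is injective. -/
theorem ι_mem_uFil_iff {n : ℕ} (hfin : FiniteDimensional k (L ⧸ 𝓕.fil n)) {x : L} :
    ι k x ∈ 𝓕.uFil n ↔ x ∈ 𝓕.fil n :=
  ⟨fun h => 𝓕.mem_fil_of_ι_mem_wordFil hfin (𝓕.uFil_le_wordFil n _ h), 𝓕.ι_mem_uFil⟩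

end Injectivity

end LieFiltration

namespace UniversalEnvelopingAlgebra

/-! ### The second Adams operation and its eigenvalue `2` -/

section Adams

variable (k : Type*) {L L' : Type*} [CommRing k] [LieRing L] [LieAlgebra k L]
  [LieRing L'] [LieAlgebra k L']

/-- The second Adams operation of `U(L)`: the convolution square of the identity. -/
def adamsSq : UniversalEnvelopingAlgebra k L →ₗ[k] UniversalEnvelopingAlgebra k L :=
  LinearMap.mul' k _ ∘ₗ (comulHom k).toLinearMap

theorem adamsSq_apply (a : UniversalEnvelopingAlgebra k L) :
    adamsSq k a = LinearMap.mul' k _ (comulHom k a) := rfl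

theorem map_comulHom (f : L →ₗ⁅k⁆ L') (a : UniversalEnvelopingAlgebra k L) :
    comulHom k (mapHom k f a) =
      Algebra.TensorProduct.map (mapHom k f) (mapHom k f) (comulHom k a) :=
  DFunLike.congr_fun (f := (comulHom k).comp (mapHom k f))
    (g := (Algebra.TensorProduct.map (mapHom k f) (mapHom k f)).comp (comulHom k))
    (algHom_ext_ι k fun l => by simp [-ι_apply, mapHom_ι, comulHom_ι]) a

theorem mapHom_adamsSq (f : L →ₗ⁅k⁆ L') (a : UniversalEnvelopingAlgebra k L) :
    adamsSq k (mapHom k f a) = mapHom k f (adamsSq k a) := by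
  rw [adamsSq_apply, adamsSq_apply, map_comulHom]
  induction comulHom k a with
  | zero => simp
  | add x y hx hy => simp only [map_add, hx, hy]
  | tmul x y => simp

/-- The increasing filtration of `U(L)` by the length of words. -/
def lenFil (d : ℕ) : Submodule k (UniversalEnvelopingAlgebra k L) :=
  (1 ⊔ LinearMap.range (ιLin k)) ^ d

theorem lenFil_mono : Monotone (lenFil k (L := L)) := fun _ _ h =>
  pow_le_pow_right₀ le_sup_left h

theorem lenFil_mul (i j : ℕ) : lenFil k (L := L) i * lenFil k j = lenFil k (i + j) :=
  (pow_add _ i j).symm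

theorem one_mem_lenFil (d : ℕ) : (1 : UniversalEnvelopingAlgebra k L) ∈ lenFil k d :=
  lenFil_mono k (Nat.zero_le d) (by rw [lenFil, pow_zero]; exact Submodule.one_le.1 le_rfl)

theorem mul_mem_lenFil {i j : ℕ} {a b : UniversalEnvelopingAlgebra k L} (ha : a ∈ lenFil k i)
    (hb : b ∈ lenFil k j) : a * b ∈ lenFil k (i + j) :=
  lenFil_mul k (L := L) i j ▸ Submodule.mul_mem_mul ha hb

theorem ι_mem_lenFil (x : L) : ι k x ∈ lenFil k 1 := by
  rw [lenFil, pow_one]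
  exact Submodule.mem_sup_right ⟨x, rfl⟩

theorem exists_mem_lenFil (a : UniversalEnvelopingAlgebra k L) : ∃ d, a ∈ lenFil k d := by
  let S : Subalgebra k (UniversalEnvelopingAlgebra k L) :=
    { carrier := {a | ∃ d, a ∈ lenFil k d}
      mul_mem' := fun ⟨i, hi⟩ ⟨j, hj⟩ => ⟨i + j, mul_mem_lenFil k hi hj⟩
      add_mem' := fun ⟨i, hi⟩ ⟨j, hj⟩ => ⟨max i j, add_mem (lenFil_mono k (le_max_left i j) hi)
        (lenFil_mono k (le_max_right i j) hj)⟩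
      algebraMap_mem' := fun r => ⟨0, by
        rw [Algebra.algebraMap_eq_smul_one]; exact Submodule.smul_mem _ _ (one_mem_lenFil k 0)⟩ }
  exact induction_ι k (S := S) (fun l => ⟨1, ι_mem_lenFil k l⟩) a

/-- Words of length at most `d + 1` are spanned by words of length at most `d` and by products
of an element of `L` with such a word. -/
theorem lenFil_succ_le (d : ℕ) {S : Submodule k (UniversalEnvelopingAlgebra k L)}
    (h1 : ∀ a ∈ lenFil k d, a ∈ S) (h2 : ∀ x, ∀ a ∈ lenFil k d, ι k x * a ∈ S) :
    lenFil k (d + 1) ≤ S := by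
  rw [lenFil, pow_succ', Submodule.mul_le]
  intro m hm n hn
  obtain ⟨c, hc, _, ⟨x, rfl⟩, rfl⟩ := Submodule.mem_sup.1 hm
  obtain ⟨r, rfl⟩ := Submodule.mem_one.1 hc
  rw [add_mul, ← Algebra.smul_def]
  exact add_mem (S.smul_mem _ (h1 n hn)) (h2 x n hn)

/-- The graded algebra for word length is commutative: moving `x` past a letter `y` replaces the two
letters by the single letter `[y, x]`. -/
theorem commutator_mem_lenFil (x : L) (d : ℕ) : ∀ a ∈ lenFil k (L := L) d,
    a * ι k x - ι k x * a ∈ lenFil k d := by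
  induction d with
  | zero =>
    intro a ha
    rw [lenFil, pow_zero] at ha
    obtain ⟨r, rfl⟩ := Submodule.mem_one.1 ha
    rw [Algebra.commutes, sub_self]
    exact zero_mem _
  | succ d ih =>
    refine lenFil_succ_le k d (S := (lenFil k (d + 1)).comap
      (LinearMap.mulRight k (ι k x) - LinearMap.mulLeft k (ι k x))) (fun a ha => ?_)
      fun y a ha => ?_
    · exact lenFil_mono k d.le_succ (ih a ha)
    · change ι k y * a * ι k x - ι k x * (ι k y * a) ∈ lenFil k (d + 1)
      have h : ι k y * a * ι k x - ι k x * (ι k y * a) =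
          ι k y * (a * ι k x - ι k x * a) + ι k ⁅y, x⁆ * a := by
        rw [LieHom.map_lie, LieRing.of_associative_ring_bracket]
        noncomm_ring
      rw [h, add_comm d 1]
      exact add_mem (mul_mem_lenFil k (ι_mem_lenFil k _) (ih a ha))
        (mul_mem_lenFil k (ι_mem_lenFil k _) ha)

/-- The increasing filtration of `U(L) ⊗ U(L)` by the total length of words. -/
def lenFil₂ (d : ℕ) : Submodule k
    (UniversalEnvelopingAlgebra k L ⊗[k] UniversalEnvelopingAlgebra k L) :=
  Submodule.span k {z | ∃ i j, i + j = d ∧ ∃ a ∈ lenFil k i, ∃ b ∈ lenFil k j, a ⊗ₜ b = z}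

theorem lenFil₂_le {d : ℕ} {S : Submodule k
    (UniversalEnvelopingAlgebra k L ⊗[k] UniversalEnvelopingAlgebra k L)}
    (h : ∀ i j, i + j = d → ∀ a ∈ lenFil k i, ∀ b ∈ lenFil k j, a ⊗ₜ b ∈ S) :
    lenFil₂ k d ≤ S :=
  Submodule.span_le.2 fun _ ⟨i, j, hij, a, ha, b, hb, e⟩ => e ▸ h i j hij a ha b hb

theorem tmul_mem_lenFil₂ {i j d : ℕ} (h : i + j = d) {a b : UniversalEnvelopingAlgebra k L}
    (ha : a ∈ lenFil k i) (hb : b ∈ lenFil k j) : a ⊗ₜ b ∈ lenFil₂ k d :=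
  Submodule.subset_span ⟨i, j, h, a, ha, b, hb, rfl⟩

theorem comulHom_mem_lenFil₂ (d : ℕ) : ∀ a ∈ lenFil k (L := L) d, comulHom k a ∈ lenFil₂ k d := by
  induction d with
  | zero =>
    intro a ha
    rw [lenFil, pow_zero] at ha
    obtain ⟨r, rfl⟩ := Submodule.mem_one.1 ha
    rw [Algebra.algebraMap_eq_smul_one, map_smul, map_one]
    exact Submodule.smul_mem _ _
      (tmul_mem_lenFil₂ k (add_zero 0) (one_mem_lenFil k 0) (one_mem_lenFil k 0))
  | succ d ih =>
    refine lenFil_succ_le k d (S := (lenFil₂ k (d + 1)).comap (comulHom k).toLinearMap)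
      (fun a ha => ?_) fun x a ha => ?_
    · change comulHom k a ∈ lenFil₂ k (d + 1)
      refine lenFil₂_le k (fun i j hij b hb c hc => ?_) (ih a ha)
      exact tmul_mem_lenFil₂ k (i := i) (j := j + 1) (by omega) hb
        (lenFil_mono k j.le_succ hc)
    · change comulHom k (ι k x * a) ∈ lenFil₂ k (d + 1)
      rw [map_mul, comulHom_ι]
      refine lenFil₂_le k (S := (lenFil₂ k (d + 1)).comap (LinearMap.mulLeft k _))
        (fun i j hij b hb c hc => ?_) (ih a ha)
      change (ι k x ⊗ₜ[k] 1 + 1 ⊗ₜ[k] ι k x) * b ⊗ₜ[k] c ∈ lenFil₂ k (d + 1)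
      rw [add_mul, Algebra.TensorProduct.tmul_mul_tmul, Algebra.TensorProduct.tmul_mul_tmul,
        one_mul, one_mul]
      exact add_mem
        (tmul_mem_lenFil₂ k (by omega) (mul_mem_lenFil k (ι_mem_lenFil k x) hb) hc)
        (tmul_mem_lenFil₂ k (by omega) hb (mul_mem_lenFil k (ι_mem_lenFil k x) hc))

/-- For `Δ a = ∑ b ⊗ c`, multiplying out `(x ⊗ 1 + 1 ⊗ x) Δ a` gives `∑ (x b c + b x c)`, which
differs from `2 x ψ(a)` only by the commutators `(b x - x b) c`, of no greater length than `a`. -/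
theorem adamsSq_ι_mul_mem (x : L) {d : ℕ} {a : UniversalEnvelopingAlgebra k L}
    (ha : a ∈ lenFil k d) : adamsSq k (ι k x * a) - (2 : k) • (ι k x * adamsSq k a) ∈
      lenFil k d := by
  rw [adamsSq_apply, adamsSq_apply, map_mul, comulHom_ι]
  refine lenFil₂_le k (S := (lenFil k d).comap
    (LinearMap.mul' k _ ∘ₗ LinearMap.mulLeft k (ι k x ⊗ₜ[k] 1 + 1 ⊗ₜ[k] ι k x) -
      (2 : k) • (LinearMap.mulLeft k (ι k x) ∘ₗ LinearMap.mul' k _)))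
        (fun i j hij b hb c hc => ?_) (comulHom_mem_lenFil₂ k d a ha)
  change LinearMap.mul' k _ ((ι k x ⊗ₜ[k] 1 + 1 ⊗ₜ[k] ι k x) * b ⊗ₜ[k] c) -
    (2 : k) • (ι k x * LinearMap.mul' k _ (b ⊗ₜ[k] c)) ∈ lenFil k d
  rw [add_mul, Algebra.TensorProduct.tmul_mul_tmul, Algebra.TensorProduct.tmul_mul_tmul,
        one_mul, one_mul, map_add, LinearMap.mul'_apply, LinearMap.mul'_apply,
        LinearMap.mul'_apply, ← hij]
  have h : ι k x * b * c + b * (ι k x * c) - (2 : k) • (ι k x * (b * c)) =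
      (b * ι k x - ι k x * b) * c := by
    rw [two_smul]; noncomm_ring
  rw [h]
  exact mul_mem_lenFil k (commutator_mem_lenFil k x i b hb) hc

/-- Each further letter contributes a factor `2` modulo shorter words. -/
theorem adamsSq_sub_mem (d : ℕ) : ∀ a ∈ lenFil k (L := L) (d + 1),
    adamsSq k a - (2 ^ (d + 1) : k) • a ∈ lenFil k d := by
  have hone : adamsSq k (1 : UniversalEnvelopingAlgebra k L) = 1 := by
    rw [adamsSq_apply, map_one (comulHom k (L := L)), Algebra.TensorProduct.one_def, LinearMap.mul'_apply, mul_one]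
  have h0 : ∀ a ∈ lenFil k (L := L) 0, adamsSq k a = a := by
    intro a ha
    rw [lenFil, pow_zero] at ha
    obtain ⟨r, rfl⟩ := Submodule.mem_one.1 ha
    rw [Algebra.algebraMap_eq_smul_one, map_smul, hone]
  -- The inductive step is isolated because there is no filtration piece below length `0`: for `d =
  -- 0` its inputs come from `ψ` being the identity on scalars, for larger `d` from the inductive
  -- hypothesis.
  have hstep : ∀ d : ℕ, (∀ a ∈ lenFil k (L := L) d, adamsSq k a ∈ lenFil k d) →
      (∀ x : L, ∀ a ∈ lenFil k (L := L) d, ι k x * adamsSq k a - (2 ^ d : k) • (ι k x * a) ∈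
        lenFil k d) → ∀ a ∈ lenFil k (L := L) (d + 1),
    adamsSq k a - (2 ^ (d + 1) : k) • a ∈ lenFil k d := by
    intro d h1 h2
    refine lenFil_succ_le k d (S := (lenFil k d).comap
      (adamsSq k (L := L) - (2 ^ (d + 1) : k) • LinearMap.id)) (fun a ha => ?_) fun x a ha => ?_
    · exact sub_mem (h1 a ha) (Submodule.smul_mem _ _ ha)
    · change adamsSq k (ι k x * a) - (2 ^ (d + 1) : k) • (ι k x * a) ∈ lenFil k d
      have := add_mem (adamsSq_ι_mul_mem k x ha) (Submodule.smul_mem _ (2 : k) (h2 x a ha))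
      rwa [smul_sub, smul_smul, ← pow_succ', sub_add_sub_cancel] at this
  induction d with
  | zero =>
    refine hstep 0 (fun a ha => by rwa [h0 a ha]) fun x a ha => ?_
    rw [h0 a ha, pow_zero, one_smul, sub_self]
    exact zero_mem _
  | succ d ih =>
    refine hstep (d + 1) (fun a ha => ?_) fun x a ha => ?_
    · have := add_mem (lenFil_mono k d.le_succ (ih a ha))
        (Submodule.smul_mem _ (2 ^ (d + 1) : k) ha)
      rwa [sub_add_cancel] at this
    · have := mul_mem_lenFil k (ι_mem_lenFil k x) (ih a ha)
      rwa [mul_sub, mul_smul_comm, add_comm 1 d] at this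

/-- The eigenspace of the second Adams operation for the eigenvalue `2` is `L`, modulo any
submodule of the augmentation ideal that is stable under the operation. -/
theorem exists_sub_ι_mem_of_adamsSq_sub_mem {k L : Type*} [Field k] [CharZero k] [LieRing L]
    [LieAlgebra k L] {J : Submodule k (UniversalEnvelopingAlgebra k L)}
    (hJ : ∀ a ∈ J, adamsSq k a ∈ J) (hJ1 : ∀ a ∈ J, counitHom k a = 0)
    {a : UniversalEnvelopingAlgebra k L}
    (ha : adamsSq k a - (2 : k) • a ∈ J) : ∃ x, a - ι k x ∈ J := by
  have h1 : ∀ d, ∀ a ∈ lenFil k (L := L) (d + 1), adamsSq k a - (2 : k) • a ∈ J →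
      ∃ b ∈ lenFil k (L := L) 1, a - b ∈ J := by
    intro d
    induction d with
    | zero => exact fun a ha _ => ⟨a, ha, by rw [sub_self]; exact zero_mem _⟩
    | succ d ih =>
      intro a had ha
      -- The element `ψ(a) - 2ᵈ⁺² a` is shorter than `a`, and modulo `J` it equals `(2 - 2ᵈ⁺²) a`, a
      -- nonzero multiple of `a` in characteristic zero.
      obtain ⟨b, hb, hab⟩ := ih _ (adamsSq_sub_mem k (d + 1) a had) (by
        have h : adamsSq k (adamsSq k a - (2 ^ (d + 1 + 1) : k) • a) -
            (2 : k) • (adamsSq k a - (2 ^ (d + 1 + 1) : k) • a) =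
            adamsSq k (adamsSq k a - (2 : k) • a) -
              (2 ^ (d + 1 + 1) : k) • (adamsSq k a - (2 : k) • a) := by
          simp only [map_sub, map_smul]
          module
        rw [h]
        exact sub_mem (hJ _ ha) (J.smul_mem _ ha))
      have hc : (2 - 2 ^ (d + 1 + 1) : k) ≠ 0 := by
        rw [sub_ne_zero]
        norm_cast
        rw [pow_succ']
        have := Nat.one_lt_two_pow (n := d + 1) (by omega)
        omega
      refine ⟨(2 - 2 ^ (d + 1 + 1) : k)⁻¹ • b, Submodule.smul_mem _ _ hb, ?_⟩
      have h := J.smul_mem (2 - 2 ^ (d + 1 + 1) : k)⁻¹ (sub_mem hab ha)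
      convert h using 1
      rw [show adamsSq k a - (2 ^ (d + 1 + 1) : k) • a - b - (adamsSq k a - (2 : k) • a) =
        (2 - 2 ^ (d + 1 + 1) : k) • a - b by module, smul_sub, inv_smul_smul₀ hc]
  obtain ⟨d, hd⟩ := exists_mem_lenFil k a
  obtain ⟨b, hb, hab⟩ := h1 d a (lenFil_mono k d.le_succ hd) ha
  rw [lenFil, pow_one] at hb
  obtain ⟨c, hc, _, ⟨x, rfl⟩, rfl⟩ := Submodule.mem_sup.1 hb
  obtain ⟨r, rfl⟩ := Submodule.mem_one.1 hc
  -- The scalar part has eigenvalue `1` rather than `2`, so it lies in `J`; the counit, which kills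
  -- `J`, shows that it is zero.
  have h2 : adamsSq k (algebraMap k _ r + ιLin k x) -
      (2 : k) • (algebraMap k _ r + ιLin k x) = -algebraMap k (UniversalEnvelopingAlgebra k L) r := by
    rw [map_add, adamsSq_apply, adamsSq_apply, AlgHom.commutes, ιLin_apply, comulHom_ι, map_add,
      Algebra.TensorProduct.algebraMap_apply, LinearMap.mul'_apply, LinearMap.mul'_apply,
      LinearMap.mul'_apply, mul_one, mul_one, one_mul, two_smul]
    abel
  have h3 : -algebraMap k (UniversalEnvelopingAlgebra k L) r ∈ J := by
    have := sub_mem ha (sub_mem (hJ _ hab) (J.smul_mem (2 : k) hab))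
    rw [← h2]
    convert this using 1
    simp only [map_sub, smul_sub]
    abel
  have hr : r = 0 := by simpa using hJ1 _ h3
  refine ⟨x, ?_⟩
  simpa [-ι_apply, hr, ιLin_apply] using hab

end Adams

end UniversalEnvelopingAlgebra

namespace LieFiltration

open UniversalEnvelopingAlgebra

/-! ### Powers of the augmentation ideal -/

section AugmentationPowers

variable (k L : Type*) [CommRing k] [LieRing L] [LieAlgebra k L]

/-- The filtration of `L` induced by the powers of the augmentation ideal of `U(L)`. -/
def augFiltration : LieFiltration k L where
  fil i :=
    { ((aug k L ^ i).restrictScalars k).comap (ιLin k) with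
      lie_mem := fun {a b} hb => by
        change ι k ⁅a, b⁆ ∈ aug k L ^ i
        have hb' : ι k b ∈ aug k L ^ i := hb
        rw [LieHom.map_lie, LieRing.of_associative_ring_bracket]
        exact sub_mem (Ideal.mul_mem_left _ _ hb') (Ideal.IsTwoSided.mul_mem_of_left _ hb') }
  fil_one := eq_top_iff.2 fun x _ => by
    change ι k x ∈ aug k L ^ 1
    rw [Submodule.pow_one]
    exact counitHom_ι k x
  anti i j h x hx := Ideal.pow_le_pow_right h hx
  lie_mem i j x hx y hy := by
    change ι k ⁅x, y⁆ ∈ aug k L ^ (i + j)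
    have hx' : ι k x ∈ aug k L ^ i := hx
    have hy' : ι k y ∈ aug k L ^ j := hy
    rw [LieHom.map_lie, LieRing.of_associative_ring_bracket]
    refine sub_mem ?_ ?_
    · rw [Ideal.IsTwoSided.pow_add]; exact Ideal.mul_mem_mul hx' hy'
    · rw [add_comm, Ideal.IsTwoSided.pow_add]; exact Ideal.mul_mem_mul hy' hx'

/-- Together with `aug_pow_le_uFil` this identifies the powers of `U(L)₊` as an instance of `F`, so
the general statement on coproducts applies to them. -/
theorem uFil_augFiltration (n : ℕ) : (augFiltration k L).uFil n ≤ aug k L ^ n := by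
  induction n with
  | zero => rw [Submodule.pow_zero, Ideal.one_eq_top]; exact le_top
  | succ n ih =>
    refine (augFiltration k L).uFil_succ_le n (S := (aug k L ^ (n + 1)).toAddSubgroup)
      (fun a ha b hb => ?_) fun a x hx b => ?_
    · change a * b ∈ aug k L ^ (n + 1)
      rw [Submodule.pow_succ]
      exact Ideal.mul_mem_mul (ih ha) hb
    · exact Ideal.IsTwoSided.mul_mem_of_left _ (Ideal.mul_mem_left _ _ hx)

variable {k L}

theorem aug_pow_le_uFil (𝓕 : LieFiltration k L) (n : ℕ) : aug k L ^ n ≤ 𝓕.uFil n := by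
  induction n with
  | zero => exact le_top
  | succ n ih => rw [Submodule.pow_succ]; exact (Ideal.mul_mono_left ih).trans (𝓕.mul_aug_le n)

/-- The coproduct spreads the `n`-th power over products of powers with exponents adding to `n`, and
multiplication recombines these. The recombination uses multiplicativity, which `F` may lack. -/
theorem adamsSq_mem_aug_pow {n : ℕ} {a : UniversalEnvelopingAlgebra k L} (ha : a ∈ aug k L ^ n) :
    adamsSq k a ∈ aug k L ^ n := by
  have h := (augFiltration k L).comulHom_mem_tensorFil n a (aug_pow_le_uFil _ n ha)
  have hle : (augFiltration k L).tensorFil n ≤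
      (aug k L ^ n).toAddSubgroup.comap (LinearMap.mul' k _).toAddMonoidHom := by
    refine (AddSubgroup.closure_le _).2 ?_
    rintro _ ⟨i, j, h, x, hx, y, hy, rfl⟩
    change LinearMap.mul' k _ (x ⊗ₜ[k] y) ∈ aug k L ^ n
    rw [LinearMap.mul'_apply, ← h, Ideal.IsTwoSided.pow_add]
    exact Ideal.mul_mem_mul (uFil_augFiltration k L i hx) (uFil_augFiltration k L j hy)
  exact hle h

/-- Once `Lᵖ = 0`, the ideals `(Lⁱ)` with `i ≥ p` contribute nothing, so each step beyond `Fᵖ ⊆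
U(L)₊` just multiplies by `U(L)₊`. -/
theorem uFil_le_aug_pow (𝓕 : LieFiltration k L) {p : ℕ} (hp : 1 ≤ p) (h : 𝓕.fil p = ⊥) (n : ℕ) :
    𝓕.uFil (p + n) ≤ aug k L ^ (n + 1) := by
  induction n with
  | zero =>
    rw [zero_add, Submodule.pow_one, add_zero]
    exact 𝓕.uFil_anti hp
  | succ n ih =>
    refine 𝓕.uFil_succ_le (p + n) (S := (aug k L ^ (n + 1 + 1)).toAddSubgroup)
      (fun a ha b hb => ?_) fun a x hx b => ?_
    · change a * b ∈ aug k L ^ (n + 1 + 1)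
      rw [Submodule.pow_succ]
      exact Ideal.mul_mem_mul (ih ha) hb
    · have h0 : x ∈ 𝓕.fil p := 𝓕.anti (by omega) hx
      rw [h, LieSubmodule.mem_bot] at h0
      rw [h0, map_zero, mul_zero, zero_mul]
      exact zero_mem _

end AugmentationPowers

/-! ### Approximately primitive elements -/

section Primitive

variable {k L : Type*} [Field k] [CharZero k] [LieRing L] [LieAlgebra k L] (𝓕 : LieFiltration k L)

/-- Elements of `U(L)` which are primitive to a high order are close to `L`. -/
theorem exists_sub_ι_mem_uFil (n : ℕ) {a : UniversalEnvelopingAlgebra k L}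
    (ha : adamsSq k a - (2 : k) • a ∈ 𝓕.uFil (n + 1 + n)) : ∃ x, a - ι k x ∈ 𝓕.uFil (n + 1) := by
  have hbot : (𝓕.quot n).fil (n + 1) = ⊥ := by
    refine eq_bot_iff.2 fun x hx => ?_
    obtain ⟨x, hx', rfl⟩ := 𝓕.mem_quot.1 hx
    exact (LieSubmodule.mem_bot _).2 (𝓕.toLq_eq_zero.2 hx')
  -- In `L_n` the filtration vanishes from index `n + 1` on, so `F²ⁿ⁺¹` of `U(L_n)` lies in the
  -- power `n + 1` of the augmentation ideal; this fixes the precision `n + 1 + n` in the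
  -- hypothesis.
  have h1 := uFil_le_aug_pow (𝓕.quot n) (by omega) hbot n (𝓕.mapHom_mem_uFil n _ _ ha)
  rw [map_sub, map_smul, ← mapHom_adamsSq] at h1
  obtain ⟨x, hx⟩ := exists_sub_ι_mem_of_adamsSq_sub_mem
    (J := (aug k (𝓕.Lq n) ^ (n + 1)).restrictScalars k) (fun a ha => adamsSq_mem_aug_pow ha)
    (fun a ha => by
      have h : a ∈ aug k (𝓕.Lq n) ^ (n + 1) := ha
      rw [Ideal.IsTwoSided.pow_succ] at h
      exact Ideal.mul_le_left h) h1
  obtain ⟨x, rfl⟩ := 𝓕.toLq_surjective n x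
  refine ⟨x, 𝓕.toUj_self_eq_zero.1 ((𝓕.quot n).toUQ_eq_zero.2 ?_)⟩
  change mapHom k (𝓕.toLq n) (a - ι k x) ∈ _
  rw [map_sub, mapHom_ι]
  exact aug_pow_le_uFil _ _ hx

end Primitive

/-! ### Finite dimensionality of `U(L)/Fⁿ` -/

section Finite

variable {k L : Type*} [Field k] [LieRing L] [LieAlgebra k L] (𝓕 : LieFiltration k L)

theorem exists_fg_sup_fil (n : ℕ) (h : FiniteDimensional k (L ⧸ 𝓕.fil n)) :
    ∃ S : Submodule k L, S.FG ∧ S ⊔ (𝓕.fil n).toSubmodule = ⊤ := by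
  obtain ⟨S, hS⟩ := (𝓕.fil n).toSubmodule.exists_isCompl
  have e := Submodule.quotientEquivOfIsCompl _ _ hS
  have : FiniteDimensional k S := Module.Finite.equiv e
  exact ⟨S, (Submodule.fg_top S).1 Module.Finite.fg_top, hS.symm.sup_eq_top⟩

/-- If `W` spans `U(L)` modulo `Fⁿ` and `S` spans `L` modulo `Lⁿ⁺¹`, then `U(L)₊ = U(L)·L` is `W·S`
modulo `Fⁿ⁺¹`: the other terms lie in `Fⁿ·U(L)₊` or in the ideal generated by `Lⁿ⁺¹`. Adding the
scalars gives all of `U(L)`. -/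
theorem exists_fg_sup_uFil (hfin : ∀ p, FiniteDimensional k (𝓕.Lq p)) (n : ℕ) :
    ∃ W : Submodule k (UniversalEnvelopingAlgebra k L), W.FG ∧
      W ⊔ (𝓕.uFil n).restrictScalars k = ⊤ := by
  induction n with
  | zero => exact ⟨⊥, Submodule.fg_bot, by rw [bot_sup_eq]; rfl⟩
  | succ n ih =>
    obtain ⟨W, hW, hWt⟩ := ih
    obtain ⟨S, hS, hSt⟩ := 𝓕.exists_fg_sup_fil (n + 1) (hfin n)
    refine ⟨1 ⊔ W * S.map (ιLin k (L := L)), Submodule.FG.sup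
      (by rw [Submodule.one_eq_span]; exact Submodule.fg_span_singleton _)
      (hW.mul (hS.map _)), top_le_iff.1 fun u _ => ?_⟩
    have haug : ∀ b ∈ aug k L, b ∈ W * S.map (ιLin k (L := L)) ⊔ (𝓕.uFil (n + 1)).restrictScalars k := by
      intro b hb
      refine Submodule.mul_induction_on (mem_top_mul_range_of_mem_aug hb) (fun c _ d hd => ?_)
        fun x y hx hy => add_mem hx hy
      obtain ⟨l, rfl⟩ := hd
      obtain ⟨s, hs, l, hl, rfl⟩ := Submodule.mem_sup.1 (hSt ▸ Submodule.mem_top : l ∈ S ⊔ _)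
      obtain ⟨w, hw, f, hf, rfl⟩ := Submodule.mem_sup.1 (hWt ▸ Submodule.mem_top : c ∈ W ⊔ _)
      rw [map_add, mul_add, add_mul]
      refine add_mem (add_mem (Submodule.mem_sup_left
        (Submodule.mul_mem_mul hw ⟨s, hs, rfl⟩)) (Submodule.mem_sup_right ?_))
        (Submodule.mem_sup_right ?_)
      · exact 𝓕.mul_aug_le n (Ideal.mul_mem_mul hf (counitHom_ι k s))
      · exact Ideal.mul_mem_left _ _ (𝓕.ι_mem_uFil hl)
    have hu := haug (u - algebraMap k _ (counitHom k u)) (by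
      rw [RingHom.mem_ker, map_sub, AlgHom.commutes]; simp)
    have h1 : algebraMap k (UniversalEnvelopingAlgebra k L) (counitHom k u) ∈
        (1 : Submodule k (UniversalEnvelopingAlgebra k L)) := Submodule.mem_one.2 ⟨_, rfl⟩
    rw [sup_assoc]
    have := Submodule.add_mem_sup h1 hu
    rwa [add_sub_cancel] at this

theorem finiteDimensional_UQ (hfin : ∀ p, FiniteDimensional k (𝓕.Lq p)) (n : ℕ) :
    FiniteDimensional k (𝓕.UQ n) := by
  obtain ⟨W, hW, hWt⟩ := 𝓕.exists_fg_sup_uFil hfin n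
  have h : W.map (𝓕.toUQ n).toLinearMap = ⊤ := by
    refine top_le_iff.1 fun u _ => ?_
    obtain ⟨u, rfl⟩ := 𝓕.toUQ_surjective n u
    obtain ⟨w, hw, f, hf, rfl⟩ := Submodule.mem_sup.1 (hWt ▸ Submodule.mem_top : u ∈ W ⊔ _)
    refine ⟨w, hw, ?_⟩
    rw [map_add, 𝓕.toUQ_eq_zero.2 hf, add_zero]
    rfl
  exact ⟨h ▸ hW.map _⟩

end Finite

end LieFiltration

/-- Pure tensors of functionals separate the points of a tensor product of vector spaces. -/
theorem TensorProduct.eq_of_forall_dual_map {k V W : Type*} [Field k] [AddCommGroup V] [Module k V]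
    [AddCommGroup W] [Module k W] {z z' : V ⊗[k] W}
    (h : ∀ (f : Module.Dual k V) (g : Module.Dual k W),
      LinearMap.mul' k k (TensorProduct.map f g z) = LinearMap.mul' k k (TensorProduct.map f g z')) :
    z = z' := by
  let b := Module.Basis.ofVectorSpace k V
  let c := Module.Basis.ofVectorSpace k W
  have key : ∀ i j (z : V ⊗[k] W), (b.tensorProduct c).repr z (i, j) =
      LinearMap.mul' k k (TensorProduct.map (b.coord i) (c.coord j) z) := by
    intro i j z
    induction z with
    | zero => simp
    | add x y hx hy => simp only [map_add, Finsupp.add_apply, hx, hy]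
    | tmul x y => simp [mul_comm]
  refine (b.tensorProduct c).ext_elem fun ⟨i, j⟩ => ?_
  rw [key, key, h]

namespace LieFiltration

open UniversalEnvelopingAlgebra

/-! ### The pairing of `Û(L)` with `U^c(K)` -/

section Duality

variable {k L : Type*} [CommRing k] [LieRing L] [LieAlgebra k L] (𝓕 : LieFiltration k L)

/-- A functional on `U(L)/Fⁿ`, as an element of `U^c(K)`. -/
def ucOfDual (n : ℕ) : Module.Dual k (𝓕.UQ n) →ₗ[k] 𝓕.Uc where
  toFun g := ⟨WithConv.toConv (g ∘ₗ (𝓕.toUQ n).toLinearMap), 𝓕.mem_Uc.2 ⟨n, fun x hx => by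
    change g (𝓕.toUQ n x) = 0
    rw [𝓕.toUQ_eq_zero.2 hx, map_zero]⟩⟩
  map_add' _ _ := rfl
  map_smul' _ _ := rfl

theorem ucOfDual_apply {n : ℕ} (g : Module.Dual k (𝓕.UQ n)) (x : UniversalEnvelopingAlgebra k L) :
    (𝓕.ucOfDual n g).1.ofConv x = g (𝓕.toUQ n x) := rfl

theorem ucOfDual_comp_factor {m n : ℕ} (h : m ≤ n) (g : Module.Dual k (𝓕.UQ m)) :
    𝓕.ucOfDual n (g ∘ₗ (𝓕.UQFactor h).toLinearMap) = 𝓕.ucOfDual m g := rfl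

theorem exists_ucOfDual_eq (f : 𝓕.Uc) : ∃ n, ∃ g, 𝓕.ucOfDual n g = f := by
  obtain ⟨n, hn⟩ := 𝓕.mem_Uc.1 f.2
  exact ⟨n, 𝓕.liftUQ f.1.ofConv hn, rfl⟩

theorem duality_ucOfDual {n : ℕ} (u : 𝓕.Uhat) (g : Module.Dual k (𝓕.UQ n)) :
    𝓕.duality u (𝓕.ucOfDual n g) = g (𝓕.proj n u) := by
  have h : ∀ x ∈ 𝓕.uFil n, (𝓕.ucOfDual n g).1.ofConv x = 0 := fun x hx => by
    rw [ucOfDual_apply, 𝓕.toUQ_eq_zero.2 hx, map_zero]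
  obtain ⟨x, hx⟩ := 𝓕.toUQ_surjective n (𝓕.proj n u)
  refine (𝓕.pairing_eq u _ h).trans ?_
  rw [← hx, liftUQ_toUQ, ucOfDual_apply]

theorem duality_toUhat (a : UniversalEnvelopingAlgebra k L) (f : 𝓕.Uc) :
    𝓕.duality (𝓕.toUhat a) f = f.1.ofConv a := by
  obtain ⟨n, g, rfl⟩ := 𝓕.exists_ucOfDual_eq f
  rw [duality_ucOfDual]
  rfl

theorem mul_apply (f g : 𝓕.Uc) (a : UniversalEnvelopingAlgebra k L) :
    (f * g).1.ofConv a =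
      LinearMap.mul' k k (TensorProduct.map f.1.ofConv g.1.ofConv (comulHom k a)) := rfl

theorem comulHat_apply {p : ℕ} {u : 𝓕.Uhat} {a : UniversalEnvelopingAlgebra k L}
    (h : 𝓕.toUQ (2 * p - 1) a = 𝓕.proj (2 * p - 1) u) :
    (𝓕.comulHat u).1 p = TensorProduct.map (𝓕.toUQ p).toLinearMap (𝓕.toUQ p).toLinearMap
      (comulHom k a) := by
  change 𝓕.comulUQ p (𝓕.proj (2 * p - 1) u) = _
  rw [← h, comulUQ_toUQ]
  rfl

/-- The product of `U^c(K)` is dual to the completed coproduct. -/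
theorem duality_mul {p : ℕ} (u : 𝓕.Uhat) (f g : Module.Dual k (𝓕.UQ p)) :
    𝓕.duality u (𝓕.ucOfDual p f * 𝓕.ucOfDual p g) =
      LinearMap.mul' k k (TensorProduct.map f g ((𝓕.comulHat u).1 p)) := by
  obtain ⟨a, ha⟩ := 𝓕.toUQ_surjective _ (𝓕.proj (2 * p - 1) u)
  have hmul : ∀ a, (𝓕.ucOfDual p f * 𝓕.ucOfDual p g).1.ofConv a =
      LinearMap.mul' k k (TensorProduct.map f g
        (TensorProduct.map (𝓕.toUQ p).toLinearMap (𝓕.toUQ p).toLinearMap (comulHom k a))) := by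
    intro a
    rw [mul_apply, ← LinearMap.comp_apply (TensorProduct.map f g), ← TensorProduct.map_comp]
    rfl
  -- If `i + j = 2p - 1` with `p ≥ 1`, then `i ≥ p` or `j ≥ p`, so one factor of every tensor is
  -- killed; for `p = 0` both functionals vanish.
  have hv : ∀ x ∈ 𝓕.uFil (2 * p - 1), (𝓕.ucOfDual p f * 𝓕.ucOfDual p g).1.ofConv x = 0 := by
    intro x hx
    rw [hmul, 𝓕.map_comulHom_eq_zero le_rfl _ _ (fun _ => 𝓕.toUQ_eq_zero.2)
      (fun _ => 𝓕.toUQ_eq_zero.2) hx, map_zero, map_zero]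
  refine (𝓕.pairing_eq u _ hv).trans ?_
  rw [← ha, liftUQ_toUQ, hmul, 𝓕.comulHat_apply ha]

theorem duality_one (u : 𝓕.Uhat) : 𝓕.duality u 1 = 𝓕.counitHat u := by
  have hv : ∀ x ∈ 𝓕.uFil 1, (1 : 𝓕.Uc).1.ofConv x = 0 := fun x hx => by
    change (1 : WithConv (Module.Dual k (UniversalEnvelopingAlgebra k L))) x = 0
    rw [LinearMap.convOne_apply, counit_eq, show counitHom k x = 0 from hx, map_zero]
  obtain ⟨a, ha⟩ := 𝓕.toUQ_surjective _ (𝓕.proj 1 u)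
  refine (𝓕.pairing_eq u _ hv).trans ?_
  change _ = Ideal.Quotient.liftₐ (𝓕.uFil 1) (counitHom k (L := L)) (fun _ h => h) (𝓕.proj 1 u)
  rw [← ha, liftUQ_toUQ]
  rfl

theorem counitUc_ucOfDual {n : ℕ} (g : Module.Dual k (𝓕.UQ n)) :
    𝓕.counitUc (𝓕.ucOfDual n g) = g 1 := by
  change g (𝓕.toUQ n 1) = g 1
  rw [map_one]

theorem exists_ucOfDual_eq₂ (f g : 𝓕.Uc) :
    ∃ n, ∃ f' g', 𝓕.ucOfDual n f' = f ∧ 𝓕.ucOfDual n g' = g := by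
  obtain ⟨m, f', rfl⟩ := 𝓕.exists_ucOfDual_eq f
  obtain ⟨n, g', rfl⟩ := 𝓕.exists_ucOfDual_eq g
  exact ⟨max m n, _, _, 𝓕.ucOfDual_comp_factor (le_max_left m n) f',
    𝓕.ucOfDual_comp_factor (le_max_right m n) g'⟩

/-- Elements of `L` are primitive. This is what makes `ξ ∘ φ` an infinitesimal character. -/
theorem ucToK_mul_apply (f g : 𝓕.Uc) :
    𝓕.ucToK (f * g) = 𝓕.counitUc f • 𝓕.ucToK g + 𝓕.counitUc g • 𝓕.ucToK f := by
  ext x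
  change (f * g).1.ofConv (ι k x) = f.1.ofConv 1 * g.1.ofConv (ι k x) +
    g.1.ofConv 1 * f.1.ofConv (ι k x)
  rw [mul_apply, comulHom_ι, map_add, map_add, TensorProduct.map_tmul, TensorProduct.map_tmul,
    LinearMap.mul'_apply, LinearMap.mul'_apply]
  ring

/-- The infinitesimal character `ξ ∘ φ` attached to a functional `ξ` on `K`. -/
def homInfOfDual : Module.Dual k 𝓕.K →ₗ[k] 𝓕.HomInf where
  toFun ξ := ⟨ξ ∘ₗ 𝓕.ucToK, fun f g => by
    rw [LinearMap.comp_apply, ucToK_mul_apply, map_add, map_smul, map_smul, smul_eq_mul,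
      smul_eq_mul, mul_comm (𝓕.counitUc g)]
    rfl⟩
  map_add' _ _ := rfl
  map_smul' _ _ := rfl

/-- Evaluation of the elements of `K` on `L`. -/
def evalK : L →ₗ[k] Module.Dual k 𝓕.K :=
  LinearMap.flip 𝓕.K.subtype

theorem duality_ιHat (x : L) : 𝓕.duality (𝓕.ιHat x) = 𝓕.homInfOfDual (𝓕.evalK x) := by
  ext f
  exact 𝓕.duality_toUhat (ι k x) f

end Duality

/-! ### Duality over a field -/

section Field

variable {k L : Type*} [Field k] [LieRing L] [LieAlgebra k L] (𝓕 : LieFiltration k L)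

/-- Linear functionals separate the points of every component `U(L)/Fⁿ`; no finiteness is involved.
-/
theorem duality_injective : Function.Injective 𝓕.duality := by
  refine (injective_iff_map_eq_zero _).2 fun u hu => ?_
  refine Subtype.ext (funext fun n => (Module.forall_dual_apply_eq_zero_iff k _).1 fun g => ?_)
  exact (𝓕.duality_ucOfDual u g).symm.trans (by rw [hu, LinearMap.zero_apply])

/-- By finite dimensionality, the restriction of `α` to the dual of `U(L)/Fⁿ` is evaluation at a
vector. The transition maps respect these vectors because the duals are nested in `U^c(K)`. -/
theorem duality_surjective (hfin : ∀ p, FiniteDimensional k (𝓕.Lq p)) :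
    Function.Surjective 𝓕.duality := by
  intro α
  have := 𝓕.finiteDimensional_UQ hfin
  have hex : ∀ n, ∃ v : 𝓕.UQ n, ∀ g, g v = α (𝓕.ucOfDual n g) := fun n =>
    ⟨(Module.evalEquiv k (𝓕.UQ n)).symm (α ∘ₗ 𝓕.ucOfDual n), fun g => by
      rw [Module.apply_evalEquiv_symm_apply]; rfl⟩
  choose v hv using hex
  refine ⟨⟨v, fun p q h => ?_⟩, ?_⟩
  · refine (Module.forall_dual_apply_eq_zero_iff k _).1 (fun g => ?_) |> sub_eq_zero.1
    rw [map_sub, hv p g, sub_eq_zero, ← 𝓕.ucOfDual_comp_factor h g, ← hv q]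
    rfl
  · ext f
    obtain ⟨n, g, rfl⟩ := 𝓕.exists_ucOfDual_eq f
    rw [duality_ucOfDual]
    exact hv n g

/-- Multiplicativity of the functional is the equation `Δ u = u ⊗ u` tested against pure tensors of
functionals, which suffice to detect equality at each level. -/
theorem mem_grouplike_iff (u : 𝓕.Uhat) : u ∈ 𝓕.Grouplike ↔
    (∀ f g, 𝓕.duality u (f * g) = 𝓕.duality u f * 𝓕.duality u g) ∧ 𝓕.duality u 1 = 1 := by
  rw [duality_one]
  refine and_congr_left fun _ => ⟨fun h f g => ?_, fun h => ?_⟩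
  · obtain ⟨n, f, g, rfl, rfl⟩ := 𝓕.exists_ucOfDual_eq₂ f g
    rw [duality_mul, h, duality_ucOfDual, duality_ucOfDual]
    change LinearMap.mul' k k (TensorProduct.map f g (𝓕.proj n u ⊗ₜ[k] 𝓕.proj n u)) = _
    rw [TensorProduct.map_tmul, LinearMap.mul'_apply]
  · refine Subtype.ext (funext fun n => TensorProduct.eq_of_forall_dual_map fun f g => ?_)
    rw [← duality_mul, h, duality_ucOfDual, duality_ucOfDual]
    change _ = LinearMap.mul' k k (TensorProduct.map f g (𝓕.proj n u ⊗ₜ[k] 𝓕.proj n u))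
    rw [TensorProduct.map_tmul, LinearMap.mul'_apply]

/-- A functional on `L/Lᵖ⁺¹` extends to `U(L)/Fᵖ⁺¹` because the former embeds in the latter. -/
theorem ucToK_surjective (hfin : ∀ p, FiniteDimensional k (𝓕.Lq p)) :
    Function.Surjective 𝓕.ucToK := by
  rintro ⟨f, p, hf⟩
  let j : L →ₗ[k] 𝓕.UQ (p + 1) := (𝓕.toUQ (p + 1)).toLinearMap ∘ₗ ιLin k
  have hj : f ∈ LinearMap.range j.dualMap := by
    -- Over a field, a functional factors through `j` as soon as it vanishes on `ker j`, which here
    -- is `Lᵖ⁺¹`.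
    rw [LinearMap.range_dualMap_eq_dualAnnihilator_ker, Submodule.mem_dualAnnihilator]
    intro x hx
    exact 𝓕.mem_Kp.1 hf x ((𝓕.ι_mem_uFil_iff (hfin p)).1 (𝓕.toUQ_eq_zero.1 hx))
  obtain ⟨g, rfl⟩ := hj
  exact ⟨𝓕.ucOfDual (p + 1) g, rfl⟩

theorem homInfOfDual_injective (hfin : ∀ p, FiniteDimensional k (𝓕.Lq p)) :
    Function.Injective 𝓕.homInfOfDual := fun ξ ξ' h => by
  ext f
  obtain ⟨f, rfl⟩ := 𝓕.ucToK_surjective hfin f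
  exact DFunLike.congr_fun (congrArg Subtype.val h) f

/-- A functional on `L_p`, as an element of `K`. -/
def kOfDual (p : ℕ) : Module.Dual k (𝓕.Lq p) →ₗ[k] 𝓕.K where
  toFun g := ⟨g ∘ₗ (𝓕.toLq p : L →ₗ[k] 𝓕.Lq p), p, g, rfl⟩
  map_add' _ _ := rfl
  map_smul' _ _ := rfl

theorem evalK_injective (hcomp : 𝓕.IsComplete) : Function.Injective 𝓕.evalK := by
  refine (injective_iff_map_eq_zero _).2 fun x hx => ?_
  refine (hcomp (fun _ => 0) fun _ _ _ => map_zero _).unique (fun p => ?_) fun p => map_zero _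
  exact (Module.forall_dual_apply_eq_zero_iff k _).1 fun g =>
    DFunLike.congr_fun hx (𝓕.kOfDual p g)

/-- A functional on `K` restricts to compatible elements of the double duals of the `L_p`, that is,
to a compatible family in the `L_p`; completeness provides its limit. -/
theorem evalK_surjective (hfin : ∀ p, FiniteDimensional k (𝓕.Lq p)) (hcomp : 𝓕.IsComplete) :
    Function.Surjective 𝓕.evalK := by
  intro ξ
  have hex : ∀ p, ∃ v : 𝓕.Lq p, ∀ g, g v = ξ (𝓕.kOfDual p g) := fun p =>
    ⟨(Module.evalEquiv k (𝓕.Lq p)).symm (ξ ∘ₗ 𝓕.kOfDual p), fun g => by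
      rw [Module.apply_evalEquiv_symm_apply]; rfl⟩
  choose v hv using hex
  obtain ⟨x, hx, -⟩ := hcomp v fun p q h => by
    refine (Module.forall_dual_apply_eq_zero_iff k _).1 (fun g => ?_) |> sub_eq_zero.1
    rw [map_sub, hv p g, sub_eq_zero,
      show 𝓕.kOfDual p g = 𝓕.kOfDual q (g ∘ₗ 𝓕.LqFactor h) from rfl, ← hv q]
    rfl
  refine ⟨x, ?_⟩
  ext ⟨_, p, g, rfl⟩
  exact (congrArg g (hx p)).trans (hv p g)

/-- The elements of `Û(L)` dual to infinitesimal characters are primitive. -/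
theorem comulHat_of_mem_homInf {u : 𝓕.Uhat} (hu : 𝓕.duality u ∈ 𝓕.HomInf) (p : ℕ) :
    (𝓕.comulHat u).1 p = 1 ⊗ₜ 𝓕.proj p u + 𝓕.proj p u ⊗ₜ 1 := by
  refine TensorProduct.eq_of_forall_dual_map fun f g => ?_
  rw [← duality_mul, hu, duality_ucOfDual, duality_ucOfDual, counitUc_ucOfDual, counitUc_ucOfDual,
    map_add, map_add, TensorProduct.map_tmul, TensorProduct.map_tmul, LinearMap.mul'_apply,
    LinearMap.mul'_apply]

end Field

/-! ### Infinitesimal characters come from `L` -/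

section InfinitesimalCharacters

variable {k L : Type*} [Field k] [CharZero k] [LieRing L] [LieAlgebra k L] (𝓕 : LieFiltration k L)

/-- Applying multiplication to `Δ u = 1 ⊗ u + u ⊗ 1` gives `ψ(a) ≡ 2a` for a representative `a` of
`u`, so `a` is close to `L`. -/
theorem exists_toUQ_ι_eq {u : 𝓕.Uhat} (hu : 𝓕.duality u ∈ 𝓕.HomInf) (n : ℕ) :
    ∃ x, 𝓕.toUQ (n + 1) (ι k x) = 𝓕.proj (n + 1) u := by
  -- The precision required by `exists_sub_ι_mem_uFil`. The representative is taken modulo `F²ᵖ⁻¹`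
  -- since that level determines `Δ u` at level `p`.
  let p := n + 1 + n
  obtain ⟨a, ha⟩ := 𝓕.toUQ_surjective _ (𝓕.proj (2 * p - 1) u)
  have hfac : ∀ m, m ≤ 2 * p - 1 → 𝓕.toUQ m a = 𝓕.proj m u := fun m hm => by
    rw [← 𝓕.UQFactor_proj hm, ← ha, UQFactor_toUQ]
  have h1 := 𝓕.comulHat_of_mem_homInf hu p
  rw [𝓕.comulHat_apply ha, ← hfac p (by omega)] at h1
  have h2 : ∀ z : UniversalEnvelopingAlgebra k L ⊗[k] UniversalEnvelopingAlgebra k L,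
      LinearMap.mul' k _ (TensorProduct.map (𝓕.toUQ p).toLinearMap (𝓕.toUQ p).toLinearMap z) =
        𝓕.toUQ p (LinearMap.mul' k _ z) := by
    intro z
    induction z with
    | zero => simp only [map_zero]
    | add x y hx hy => simp only [map_add, hx, hy]
    | tmul x y =>
      rw [TensorProduct.map_tmul, LinearMap.mul'_apply, LinearMap.mul'_apply, map_mul]
      rfl
  have h3 : 𝓕.toUQ p (adamsSq k a) = 𝓕.toUQ p a + 𝓕.toUQ p a := by
    rw [adamsSq_apply, ← h2, h1, map_add, LinearMap.mul'_apply, LinearMap.mul'_apply, mul_one,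
      one_mul]
  obtain ⟨x, hx⟩ := 𝓕.exists_sub_ι_mem_uFil n (a := a) (𝓕.toUQ_eq_zero.1 (by
    rw [map_sub, map_smul, h3, two_smul, sub_self]))
  refine ⟨x, ?_⟩
  rw [← hfac (n + 1) (by omega), eq_comm, ← sub_eq_zero, ← map_sub]
  exact 𝓕.toUQ_eq_zero.2 hx

/-- The approximations `y p` are unrelated choices in `L`, but injectivity of `L_p → U(L)/Fᵖ⁺¹`
makes their classes in the `L_p` compatible, so completeness yields a single `x`. -/
theorem exists_ιHat_eq (hfin : ∀ p, FiniteDimensional k (𝓕.Lq p)) (hcomp : 𝓕.IsComplete)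
    {u : 𝓕.Uhat} (hu : 𝓕.duality u ∈ 𝓕.HomInf) : ∃ x, 𝓕.ιHat x = u := by
  choose y hy using 𝓕.exists_toUQ_ι_eq hu
  obtain ⟨x, hx, -⟩ := hcomp (fun p => 𝓕.toLq p (y p)) fun p q h => by
    change 𝓕.toLq p (y q) = 𝓕.toLq p (y p)
    rw [← sub_eq_zero, ← map_sub, toLq_eq_zero, ← 𝓕.ι_mem_uFil_iff (hfin p), ← toUQ_eq_zero,
      map_sub, map_sub, hy p, ← 𝓕.UQFactor_toUQ (Nat.add_le_add_right h 1), hy q, UQFactor_proj,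
      sub_self]
  have hs : ∀ p, 𝓕.proj (p + 1) (𝓕.ιHat x) = 𝓕.proj (p + 1) u := fun p => by
    change 𝓕.toUQ (p + 1) (ι k x) = _
    rw [← hy p, ← sub_eq_zero, ← map_sub, ← map_sub, toUQ_eq_zero]
    refine 𝓕.ι_mem_uFil (𝓕.toLq_eq_zero.1 ?_)
    rw [map_sub, hx p, sub_self]
  refine ⟨x, Subtype.ext (funext fun n => ?_)⟩
  change 𝓕.proj n (𝓕.ιHat x) = 𝓕.proj n u
  rw [← 𝓕.UQFactor_proj n.le_succ, hs, UQFactor_proj]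

theorem homInfOfDual_surjective (hfin : ∀ p, FiniteDimensional k (𝓕.Lq p))
    (hcomp : 𝓕.IsComplete) : Function.Surjective 𝓕.homInfOfDual := by
  rintro ⟨α, hα⟩
  obtain ⟨u, rfl⟩ := 𝓕.duality_surjective hfin α
  obtain ⟨x, rfl⟩ := 𝓕.exists_ιHat_eq hfin hcomp hα
  exact ⟨𝓕.evalK x, Subtype.ext (𝓕.duality_ιHat x).symm⟩

end InfinitesimalCharacters

end LieFiltration

end

theorem mainTheorem11 {k L : Type*} [Field k] [CharZero k] [LieRing L] [LieAlgebra k L]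
    (𝓕 : LieFiltration k L) (hfin : ∀ p, FiniteDimensional k (𝓕.Lq p)) (hcomp : 𝓕.IsComplete) :
    -- the duality `Û(L) → Hom(U^c(K), k)` is an isomorphism, and via this isomorphism
    Function.Bijective 𝓕.duality ∧
    -- (a) `Hom_Inf(U^c(K), k) ≅ Hom(K, k) ≅ L`
    (∃ (eInf : 𝓕.HomInf ≃ₗ[k] Module.Dual k 𝓕.K) (eL : Module.Dual k 𝓕.K ≃ₗ[k] L),
      (∀ (ξ : Module.Dual k 𝓕.K) (f : 𝓕.Uc),
        (eInf.symm ξ : Module.Dual k 𝓕.Uc) f = ξ (𝓕.ucToK f)) ∧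
      (∀ (x : L) (f : 𝓕.K), eL.symm x f = (f : Module.Dual k L) x) ∧
      (∀ α : 𝓕.HomInf, 𝓕.duality (𝓕.ιHat (eL (eInf α))) = α)) ∧
    -- (b) `Hom_Alg(U^c(K), k) ≅ G(Û(L))`
    (∃ e : (𝓕.Uc →ₐ[k] k) ≃ 𝓕.Grouplike,
      ∀ χ : 𝓕.Uc →ₐ[k] k, 𝓕.duality (e χ) = χ.toLinearMap) := by
  have hbij : Function.Bijective 𝓕.duality := ⟨𝓕.duality_injective, 𝓕.duality_surjective hfin⟩
  refine ⟨hbij, ?_, ?_⟩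
  · let eInf := LinearEquiv.ofBijective 𝓕.homInfOfDual
      ⟨𝓕.homInfOfDual_injective hfin, 𝓕.homInfOfDual_surjective hfin hcomp⟩
    let eL := LinearEquiv.ofBijective 𝓕.evalK
      ⟨𝓕.evalK_injective hcomp, 𝓕.evalK_surjective hfin hcomp⟩
    refine ⟨eInf.symm, eL.symm, fun _ _ => rfl, fun _ _ => rfl, fun α => ?_⟩
    rw [𝓕.duality_ιHat]
    have h1 : 𝓕.evalK (eL.symm (eInf.symm α)) = eInf.symm α := eL.apply_symm_apply _
    have h2 : 𝓕.homInfOfDual (eInf.symm α) = α := eInf.apply_symm_apply _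
    rw [h1, h2]
  · let e := Equiv.ofBijective 𝓕.duality hbij
    have he : ∀ α, 𝓕.duality (e.symm α) = α := e.apply_symm_apply
    refine ⟨{ toFun := fun χ => ⟨e.symm χ.toLinearMap, (𝓕.mem_grouplike_iff _).2 ?_⟩
              invFun := fun u => AlgHom.ofLinearMap (𝓕.duality u)
                ((𝓕.mem_grouplike_iff _).1 u.2).2 ((𝓕.mem_grouplike_iff _).1 u.2).1
              left_inv := fun χ => ?_
              right_inv := fun u => ?_ }, fun χ => he _⟩
    · rw [he]
      exact ⟨map_mul χ, map_one χ⟩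
    · ext f
      exact DFunLike.congr_fun (he χ.toLinearMap) f
    · exact Subtype.ext (e.symm_apply_apply _)
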